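/- Let $\mathbb T=\bigcup_{n\ge 0}\{1,2\}^n$ be the set of finite words, let $p\in[0,1)$, $\lambda>0$, $t>0$, and let $(p(s),\lambda(s))_{s\ge0}$ solve $$p'=(1-p)(\lambda-p),\qquad \lambda'=-\lambda(1-p),\qquad (p(0),\lambda(0))=(p,\lambda).$$ Put $\rho(s)=(1-p(s))\lambda(s)$. *Derrida–Retaux tree.* Let $(e_u)_{u\in\mathbb T}$ be i.i.d. exponential variables of parameter $1$ and, independently, let $(\xi_u)_{u\in\mathbb T}$ be i.i.d. with law $\mu_0=p\,\delta_0+(1-p)\lambda e^{-\lambda x}\mathbf 1_{x>0}\,dx$. For $u\in\mathbb T$ let $b_u$ be the sum of $e_v$ over the strict ancestors (prefixes) $v$ of $u$, let $d_u=b_u+e_u$, and let $\mathcal N_s=\{u: b_u\le s<d_u\}$ (Yule tree). Define, from the leaves to the root, $X^t_s(u)=(\xi_u-(t-s))_+$ for $u\in\mathcal N_t$ and $s\in[b_u,t]$, and, if $d_v\le t$ and $s\in[b_v,d_v)$, $$X^t_s(v)=\bigl(X^t_{d_v}(v1)+X^t_{d_v}(v2)-(d_v-s)\bigr)_+ .$$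 *Red tree.* On $\{X^t_0(\varnothing)>0\}$, a particle $u\in\mathcal N_s$, $s\le t$, is red if $X^t_r(v)>0$ for all $r\le s$ and all $v\in\mathcal N_r$ that are equal to $u$ or ancestors of $u$. Relabel each red particle by erasing from its word the letters created at splittings of its ancestors where one of the two children has mass $0$ at its birth. The red tree $\mathfrak X^t$ is the process that gives, for each $s\in[0,t]$, the set $\mathfrak N^t_s$ of new labels of the red particles at time $s$ and their masses $\mathfrak X^t_s(w)$, equal to the corresponding values of $X^t_s$. **Proposition.** The event $\{X^t_0(\varnothing)>0\}$ has positive probability, and conditionally on it, the conditional law of the process $\mathfrak X^t$ on $[0,t]$ given $X^t_0(\varnothing)$ is $\mathbb P_{X^t_0(\varnothing)}$, where for $x>0$, $\mathbb P_x$ is the law of the time-inhomogeneous branching Markov process on $[0,t]$ such that: 1. it starts at time $0$ from a single particle, labelled $\varnothing$, of mass $x$; 2. the mass of each particle grows linearly at speed $1$; 3. a particle of mass $m$ at time $s$ splits at rate $\rho(t-s)m$ into two children (labelled by adding $1$ or $2$ to its word), the mass being split uniformly: the children have masses $Um$ and $(1-U)m$ with $U$ uniform on $[0,1]$ independent of the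 past; 4. particles behave independently after their splitting time. -/

import Mathlib

open MeasureTheory ProbabilityTheory Set
open scoped ENNReal unitInterval

noncomputable section

namespace DerridaRetaux

/-- Labels of individuals: finite words on a two-letter alphabet. The root is `[]` and the two
children of `u` are `u ++ [0]` and `u ++ [1]`; the ancestors of `u` are its prefixes. -/
abbrev Word := List (Fin 2)

/-! ### The Yule tree with lifetimes `e` -/

/-- Birth time: the sum of the lifetimes of the strict ancestors of `u`. -/
def birth (e : Word → ℝ) (u : Word) : ℝ := ∑ k ∈ Finset.range u.length, e (u.take k)

/-- Time at which `u` splits into its two children. -/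
def death (e : Word → ℝ) (u : Word) : ℝ := birth e u + e u

/-- The set of individuals alive at time `s`. -/
def alive (e : Word → ℝ) (s : ℝ) : Set Word := {u | birth e u ≤ s ∧ s < death e u}

/-- The individuals born no later than time `t`. -/
def bornBefore (e : Word → ℝ) (t : ℝ) : Set Word := {u | birth e u ≤ t}

/-- The largest generation reached up to time `t` (almost surely finite for the Yule tree). -/
def height (e : Word → ℝ) (t : ℝ) : ℕ := sSup (List.length '' bornBefore e t)

/-! ### The painting scheme: the Derrida-Retaux tree with leaf labels `ξ` -/

/-- The recursion from the leaves (at time `t`) to the root giving the amount of paint on the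
branch `v` at level `s`. The first argument bounds the number of generations above `v` that are
explored. -/
def paint (t : ℝ) (e ξ : Word → ℝ) : ℕ → Word → ℝ → ℝ
  | 0, _, _ => 0
  | n + 1, v, s =>
    if death e v ≤ t then
      max (paint t e ξ n (v ++ [0]) (death e v) + paint t e ξ n (v ++ [1]) (death e v)
        - (death e v - s)) 0
    else max (ξ v - (t - s)) 0

/-- The Derrida-Retaux tree `X^t_s(v)` of height `t`: all generations present at time `t` are
explored, so that `drTree_leaf` and `drTree_branch` below hold. Meaningful for `s ≤ t` and
`v ∈ alive e s`. -/
def drTree (t : ℝ) (e ξ : Word → ℝ) (s : ℝ) (v : Word) : ℝ := paint t e ξ (height e t + 1) v s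

lemma birth_child (e : Word → ℝ) (v : Word) (i : Fin 2) : birth e (v ++ [i]) = death e v := by
  simp only [birth, death, List.length_append, List.length_singleton, Finset.sum_range_succ]
  congr 1
  · refine Finset.sum_congr rfl fun k hk => ?_
    rw [List.take_append_of_le_length (Finset.mem_range.1 hk).le]
  · rw [List.take_append_of_le_length le_rfl, List.take_length]

lemma paint_succ {t : ℝ} {e : Word → ℝ} (ξ : Word → ℝ) (h : (bornBefore e t).Finite) :
    ∀ (n : ℕ) (v : Word) (s : ℝ), birth e v ≤ t → height e t < n + v.length →
      paint t e ξ (n + 1) v s = paint t e ξ n v s := by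
  intro n
  induction n with
  | zero =>
    intro v s hv hn
    exfalso
    have : v.length ≤ height e t := le_csSup (h.image _).bddAbove ⟨v, hv, rfl⟩
    omega
  | succ n ih =>
    intro v s hv hn
    by_cases hd : death e v ≤ t
    · have hc : ∀ i : Fin 2, paint t e ξ (n + 1) (v ++ [i]) (death e v)
          = paint t e ξ n (v ++ [i]) (death e v) := fun i =>
        ih _ _ (by rw [birth_child]; exact hd) (by simp; omega)
      rw [show paint t e ξ (n + 1 + 1) v s = _ from if_pos hd, hc 0, hc 1, paint, if_pos hd]
    · rw [show paint t e ξ (n + 1 + 1) v s = _ from if_neg hd, paint, if_neg hd]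

/-- The value on a branch that reaches level `t`. -/
lemma drTree_leaf {t : ℝ} {e : Word → ℝ} (ξ : Word → ℝ) (s : ℝ) {v : Word} (hv : t < death e v) :
    drTree t e ξ s v = max (ξ v - (t - s)) 0 := by
  rw [drTree, paint, if_neg (not_le.2 hv)]

/-- The value on a branch that splits before level `t`, in a tree that is finite up to level `t`. -/
lemma drTree_branch {t : ℝ} {e : Word → ℝ} (ξ : Word → ℝ) (h : (bornBefore e t).Finite) (s : ℝ)
    {v : Word} (hv : death e v ≤ t) :
    drTree t e ξ s v = max (drTree t e ξ (birth e (v ++ [0])) (v ++ [0])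
      + drTree t e ξ (birth e (v ++ [1])) (v ++ [1]) - (death e v - s)) 0 := by
  have hc : ∀ i : Fin 2, paint t e ξ (height e t + 1) (v ++ [i]) (death e v)
      = paint t e ξ (height e t) (v ++ [i]) (death e v) := fun i =>
    paint_succ ξ h _ _ _ (by rw [birth_child]; exact hv) (by simp)
  simp only [birth_child]
  rw [drTree, paint, if_pos hv, drTree, drTree, hc 0, hc 1]

/-! ### The red tree -/

/-- The red individuals at time `s`: those alive in the painted connected component of the root. -/
def red (t : ℝ) (e ξ : Word → ℝ) (s : ℝ) : Set Word :=
  {u | u ∈ alive e s ∧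
    ∀ r, 0 ≤ r → r ≤ s → ∀ v, v <+: u → v ∈ alive e r → 0 < drTree t e ξ r v}

/-- The splitting of `v` is visible in the red tree if both children of `v` bring paint. -/
def VisibleSplit (t : ℝ) (e ξ : Word → ℝ) (v : Word) : Prop :=
  ∀ i : Fin 2, 0 < drTree t e ξ (birth e (v ++ [i])) (v ++ [i])

open Classical in
/-- The label of `u` in the red tree: the letters of `u` corresponding to invisible splittings of
its ancestors are erased (the letter number `k` of `u` was appended when `u.take k` split). -/
def redLabel (t : ℝ) (e ξ : Word → ℝ) (u : Word) : Word :=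
  u.zipIdx.filterMap fun a => if VisibleSplit t e ξ (u.take a.2) then some a.1 else none

open Classical in
/-- The red tree at time `s`: the mass of the particle with label `w` in the red tree, or `none` if
there is no such particle at time `s`. -/
def redTree (t : ℝ) (e ξ : Word → ℝ) (s : ℝ) (w : Word) : Option ℝ :=
  if h : ∃ u, u ∈ red t e ξ s ∧ redLabel t e ξ u = w then some (drTree t e ξ s h.choose) else none

/-! ### Particle systems on `[0, t]` -/

/-- The disjoint-union sigma-algebra on `Option ℝ = {none} ⊔ ℝ`. -/
instance : MeasurableSpace (Option ℝ) := MeasurableSpace.map some inferInstance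

/-- Trajectories of labelled particle systems on `[0, t]`: at each time, each label carries a mass
or is absent. It is endowed with the product sigma-algebra. -/
abbrev Path (t : ℝ) := Icc (0 : ℝ) t → Word → Option ℝ

/-- The red tree, as a trajectory on `[0, t]`. -/
def redPath (t : ℝ) (e ξ : Word → ℝ) : Path t := fun s => redTree t e ξ s

/-! ### The branching Markov process with linear growth at speed `1`, splitting rate `ρ(t-s) m` at
time `s` for a particle of mass `m`, and uniform splitting of the mass -/

/-- Accumulated splitting rate on `[b, s]` of a particle of mass `m` at time `b`, whose mass at time
`r` is `m + (r - b)`. -/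
def cumRate (t : ℝ) (ρ : ℝ → ℝ) (b m s : ℝ) : ℝ := ∫ r in b..s, ρ (t - r) * (m + (r - b))

/-- The splitting time of a particle born at time `b` with mass `m`, driven by a standard
exponential variable `E`; used only if the particle splits before time `t`. -/
def splitTime (t : ℝ) (ρ : ℝ → ℝ) (b m E : ℝ) : ℝ := sInf {r | r ∈ Icc b t ∧ E ≤ cumRate t ρ b m r}

/-- The share of the mass inherited by the two children when the uniform variable is `U`. -/
def share (i : Fin 2) (U : I) : ℝ := if i = 0 then (U : ℝ) else 1 - U

/-- The mass at time `s` (`none` if absent) of the particle `w` of the system started at time `b`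
from a single particle `[]` of mass `m`, where `Z v` is the pair of the exponential variable and the
uniform variable driving the splitting of the particle `v`. -/
def branchingMass (t : ℝ) (ρ : ℝ → ℝ) : Word → (Word → ℝ × I) → ℝ → ℝ → ℝ → Option ℝ
  | [], Z, b, m, s => if (Z []).1 ≤ cumRate t ρ b m s then none else some (m + (s - b))
  | i :: w, Z, b, m, s =>
    if (Z []).1 ≤ cumRate t ρ b m s then
      branchingMass t ρ w (fun v => Z (i :: v)) (splitTime t ρ b m (Z []).1)
        (share i (Z []).2 * (m + (splitTime t ρ b m (Z []).1 - b))) s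
    else none

/-- The law of independent pairs, indexed by the particles, of a standard exponential variable and
an independent uniform variable on `[0, 1]`. -/
def noise : Measure (Word → ℝ × I) :=
  Measure.infinitePi fun _ : Word => (expMeasure 1).prod (volume : Measure I)

/-- The particle system started at time `0` from a single particle of mass `x`. -/
def branchingPath (t : ℝ) (ρ : ℝ → ℝ) (x : ℝ) (Z : Word → ℝ × I) : Path t :=
  fun s w => branchingMass t ρ w Z 0 x s

/-- The law on `Path t` of the branching Markov process started from `x`. -/
def branchingLaw (t : ℝ) (ρ : ℝ → ℝ) (x : ℝ) : Measure (Path t) :=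
  noise.map (branchingPath t ρ x)

/-- The initial law `p δ₀ + (1 - p) λ e^{-λ x} dx`. -/
def initialLaw (p lam : ℝ) : Measure ℝ :=
  ENNReal.ofReal p • Measure.dirac 0 + ENNReal.ofReal (1 - p) • expMeasure lam

end DerridaRetaux

end

open DerridaRetaux

open MeasureTheory ProbabilityTheory Set
open scoped ENNReal unitInterval

noncomputable section

namespace DerridaRetaux

/-! Attach to a particle born at time `b` its state: its mass at birth and the red path that it
generates. `flowLaw` is the law of this state when the mass has law `initialLaw (p (t - b)) (lam (t
- b))` and the path then follows the branching dynamics. The point is that the root of the painted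
Yule tree has law `flowLaw` at time `0`; restricting to positive masses then disintegrates it into a
mass and the branching kernel (`IsFlow.flowLaw_restrict`).

The heart is the invariance of `flowLaw` under one step of the Yule recursion
(`IsFlow.yuleStep_of_empty`). At a Yule splitting, either exactly one child carries mass (weight `2
p`) and the splitting is invisible, or both do. In the second case the densities at `y` and `M - y`
multiply to `ρ² e^{-λ M}`, which is `ρ` times the density at `M` and does not depend on `y`: hence a
uniform share and the rate `ρ M`. For the branching process, `meanBranch_firstSplit` decomposes at
the first visible splitting. The differential system says that, along a line of slope `1`, density
times survival probability changes by the factor `exp (-(r - q) + ∫ 2 p)`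
(`IsFlow.density_mul_exp_cumRate`). This factor is the resolvent of invisible splittings at rate `2
p`, so `volterra_of_resolvent` turns the decomposition at the first visible splitting into one at
the first Yule splitting.

Equality of laws needs no uniqueness theorem for the recursion. The trees exhausted by `n`
generations give sub-probability measures `redLaw`, which stay below `flowLaw` by induction on `n`
and monotonicity of the recursion (`IsFlow.redLaw_le`). Almost every tree is exhausted by finitely
many generations (`ae_exists_fewGenerations`), so the law of the root state is at most `flowLaw`,
and both have mass one (`IsFlow.map_redPair`). A deterministic induction, `redState_eq`, identifies
the recursive state with the red tree defined by red ancestors and erased letters. -/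

/-! ### Product measures indexed by words -/

/-- The family indexed by words with value `a` at the root and `η i` on the subtree of words
starting with the letter `i`. -/
def graft {α : Type*} (a : α) (η₀ η₁ : Word → α) : Word → α
  | [] => a
  | i :: w => if i = 0 then η₀ w else η₁ w

@[simp] lemma graft_nil {α : Type*} (a : α) (η₀ η₁ : Word → α) : graft a η₀ η₁ [] = a := rfl

@[simp] lemma graft_zero {α : Type*} (a : α) (η₀ η₁ : Word → α) (w : Word) :
    graft a η₀ η₁ (0 :: w) = η₀ w := rfl

@[simp] lemma graft_one {α : Type*} (a : α) (η₀ η₁ : Word → α) (w : Word) :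
    graft a η₀ η₁ (1 :: w) = η₁ w := rfl

lemma measurable_graft {α : Type*} [MeasurableSpace α] :
    Measurable fun z : α × (Word → α) × (Word → α) => graft z.1 z.2.1 z.2.2 := by
  refine measurable_pi_iff.2 fun w => ?_
  match w with
  | [] => exact measurable_fst
  | i :: w =>
    by_cases hi : i = 0
    · simp only [graft, hi, if_true]
      fun_prop
    · simp only [graft, hi, if_false]
      fun_prop

/-- Self-similarity of an i.i.d. family: cutting at the first letter leaves a root value and two
independent copies of the family. Both recursions, for the branching process and for the Yule tree,
rest on it. Finite boxes pull back to products of three boxes. -/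
lemma map_graft {α : Type*} [MeasurableSpace α] (μ : Measure α) [IsProbabilityMeasure μ] :
    (μ.prod ((Measure.infinitePi fun _ : Word => μ).prod (Measure.infinitePi fun _ : Word => μ))).map
      (fun z => graft z.1 z.2.1 z.2.2) = Measure.infinitePi fun _ : Word => μ := by
  classical
  refine Measure.eq_infinitePi _ fun s T hT => ?_
  -- Padding by `univ` costs no mass and allows `s` to be enlarged to the root together with both
  -- copies of one finite set of tails.
  set T' : Word → Set α := fun w => if w ∈ s then T w else univ with hT'
  have hT'm : ∀ w, MeasurableSet (T' w) := fun w => by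
    by_cases h : w ∈ s <;> simp [hT', h, hT]
  set C : Finset Word := s.image List.tail
  let c : Fin 2 → (Word ↪ Word) := fun i => ⟨List.cons i, List.cons_injective⟩
  set S : Finset Word := insert [] (C.map (c 0) ∪ C.map (c 1)) with hS
  have hsS : s ⊆ S := by
    intro w hw
    match w with
    | [] => simp [hS]
    | i :: w =>
      have : w ∈ C := Finset.mem_image.2 ⟨i :: w, hw, rfl⟩
      fin_cases i <;> simp [hS, c, this]
  have hprod : ∏ w ∈ s, μ (T w) = μ (T' []) * ((∏ w ∈ C, μ (T' (0 :: w))) *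
      ∏ w ∈ C, μ (T' (1 :: w))) := by
    have h1 : ∏ w ∈ s, μ (T w) = ∏ w ∈ S, μ (T' w) := by
      rw [← Finset.prod_subset hsS (f := fun w => μ (T' w))]
      · exact Finset.prod_congr rfl fun w hw => by simp [hT', hw]
      · intro w _ hw
        simp [hT', hw]
    rw [h1, hS, Finset.prod_insert, Finset.prod_union, Finset.prod_map, Finset.prod_map]
    · rfl
    · rw [Finset.disjoint_left]
      simp [c]
    · simp [c]
  have hset : (fun z : α × (Word → α) × (Word → α) => graft z.1 z.2.1 z.2.2) ⁻¹'
      (Set.pi s T) = T' [] ×ˢ ((Set.pi C fun w => T' (0 :: w)) ×ˢ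
        (Set.pi C fun w => T' (1 :: w))) := by
    ext ⟨a, η₀, η₁⟩
    have hmem : ∀ i w, i :: w ∈ s → w ∈ C := fun i w h => Finset.mem_image.2 ⟨i :: w, h, rfl⟩
    simp only [mem_preimage, Set.mem_pi, Finset.mem_coe, mem_prod]
    constructor
    · intro h
      refine ⟨?_, fun w _ => ?_, fun w _ => ?_⟩
      · by_cases hw : [] ∈ s
        · simpa [hT', hw] using h [] hw
        · simp [hT', hw]
      · by_cases hw : 0 :: w ∈ s
        · simpa [hT', hw] using h _ hw
        · simp [hT', hw]
      · by_cases hw : 1 :: w ∈ s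
        · simpa [hT', hw] using h _ hw
        · simp [hT', hw]
    · rintro ⟨h, h0, h1⟩ w hw
      match w with
      | [] => simpa [hT', hw] using h
      | i :: w =>
        fin_cases i
        · simpa [hT', show 0 :: w ∈ s from hw] using h0 w (hmem _ _ hw)
        · simpa [hT', show 1 :: w ∈ s from hw] using h1 w (hmem _ _ hw)
  rw [Measure.map_apply measurable_graft (MeasurableSet.pi s.countable_toSet fun w _ => hT w), hset,
    Measure.prod_prod, Measure.prod_prod, Measure.infinitePi_pi _ fun w _ => hT'm _,
    Measure.infinitePi_pi _ fun w _ => hT'm _, hprod]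

lemma lintegral_infinitePi_word {α : Type*} [MeasurableSpace α] (μ : Measure α)
    [IsProbabilityMeasure μ] {F : (Word → α) → ℝ≥0∞} (hF : Measurable F) :
    ∫⁻ η, F η ∂(Measure.infinitePi fun _ : Word => μ) =
      ∫⁻ a, ∫⁻ η₀, ∫⁻ η₁, F (graft a η₀ η₁) ∂(Measure.infinitePi fun _ : Word => μ)
        ∂(Measure.infinitePi fun _ : Word => μ) ∂μ := by
  have hFg : Measurable fun z : α × (Word → α) × (Word → α) => F (graft z.1 z.2.1 z.2.2) :=
    hF.comp measurable_graft
  conv_lhs => rw [← map_graft μ]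
  rw [lintegral_map hF measurable_graft, lintegral_prod _ hFg.aemeasurable]
  refine lintegral_congr fun a => ?_
  exact lintegral_prod _ (hFg.comp measurable_prodMk_left).aemeasurable

/-! ### Paths and their measurability -/

lemma measurable_some : Measurable (some : ℝ → Option ℝ) := fun _ h => h

/-- The system with a single particle `[]`, of mass `c + s` at time `s`. -/
def linePath (t c : ℝ) : Path t := fun s w => if w = [] then some (c + s) else none

/-- The system without particles. -/
def emptyPath (t : ℝ) : Path t := fun _ _ => none

/-- The system with a single particle, of mass `c + s` at time `s < r`, which splits at time `r`,
the descendants of its two children being given by `π₀` and `π₁`. -/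
def splitPath {t : ℝ} (c r : ℝ) (π₀ π₁ : Path t) : Path t := fun s w =>
  if (s : ℝ) < r then linePath t c s w else
    match w with
    | [] => none
    | i :: w => if i = 0 then π₀ s w else π₁ s w

section Path

variable {t : ℝ} {α : Type*} [MeasurableSpace α]

lemma measurable_path {f : α → Path t} (h : ∀ s w, Measurable fun a => f a s w) : Measurable f :=
  measurable_pi_iff.2 fun s => measurable_pi_iff.2 fun w => h s w

lemma measurable_path_apply {f : α → Path t} (hf : Measurable f) (s : Icc (0 : ℝ) t) (w : Word) :
    Measurable fun a => f a s w :=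
  (measurable_pi_apply w).comp ((measurable_pi_apply s).comp hf)

@[fun_prop]
lemma measurable_linePath : Measurable (linePath t) := by
  refine measurable_path fun s w => ?_
  by_cases hw : w = []
  · simp only [linePath, hw, if_true]
    exact measurable_some.comp (measurable_id.add_const _)
  · simpa only [linePath, hw, if_false] using measurable_const

lemma measurable_splitPath {c r : α → ℝ} {π₀ π₁ : α → Path t} (hc : Measurable c)
    (hr : Measurable r) (h₀ : Measurable π₀) (h₁ : Measurable π₁) :
    Measurable fun a => splitPath (c a) (r a) (π₀ a) (π₁ a) := by
  refine measurable_path fun s w => ?_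
  refine Measurable.ite (measurableSet_lt measurable_const hr)
    (measurable_path_apply (measurable_linePath.comp hc) s w) ?_
  match w with
  | [] => exact measurable_const
  | i :: w =>
    by_cases hi : i = 0
    · simpa only [hi, if_true] using measurable_path_apply h₀ s w
    · simpa only [hi, if_false] using measurable_path_apply h₁ s w

end Path

/-! ### The cumulative splitting rate and the splitting time -/

section Rate

variable {t : ℝ} {ρ : ℝ → ℝ}

lemma continuous_rate (hρ : Continuous ρ) (t b m : ℝ) :
    Continuous fun r => ρ (t - r) * (m + (r - b)) := by fun_prop

lemma hasDerivAt_cumRate (hρ : Continuous ρ) (t b m s : ℝ) :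
    HasDerivAt (cumRate t ρ b m) (ρ (t - s) * (m + (s - b))) s :=
  intervalIntegral.integral_hasDerivAt_right ((continuous_rate hρ t b m).intervalIntegrable _ _)
    ((continuous_rate hρ t b m).stronglyMeasurableAtFilter _ _)
    (continuous_rate hρ t b m).continuousAt

lemma continuous_cumRate (hρ : Continuous ρ) (t b m : ℝ) : Continuous (cumRate t ρ b m) :=
  continuous_iff_continuousAt.2 fun s => (hasDerivAt_cumRate hρ t b m s).continuousAt

lemma cumRate_self (t b m : ℝ) : cumRate t ρ b m b = 0 := intervalIntegral.integral_same

lemma cumRate_strictMonoOn (hρ : Continuous ρ) (hpos : ∀ s, 0 < ρ s) (t b : ℝ) {m : ℝ}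
    (hm : 0 ≤ m) : StrictMonoOn (cumRate t ρ b m) (Ici b) := by
  refine strictMonoOn_of_deriv_pos (convex_Ici b) (continuous_cumRate hρ t b m).continuousOn ?_
  intro s hs
  rw [interior_Ici] at hs
  rw [(hasDerivAt_cumRate hρ t b m s).deriv]
  exact mul_pos (hpos _) (by linarith [show b < s from hs])

lemma continuous_cumRate_uncurry (hρ : Continuous ρ) (t : ℝ) :
    Continuous fun z : ℝ × ℝ × ℝ => cumRate t ρ z.1 z.2.1 z.2.2 := by
  have hf : Continuous (Function.uncurry fun (z : ℝ × ℝ × ℝ) (r : ℝ) =>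
      ρ (t - r) * (z.2.1 + (r - z.1))) := by
    unfold Function.uncurry
    fun_prop
  have h1 := intervalIntegral.continuous_parametric_intervalIntegral_of_continuous
    (μ := volume) (a₀ := 0) hf (s := fun z => z.2.2) (by fun_prop)
  have h2 := intervalIntegral.continuous_parametric_intervalIntegral_of_continuous
    (μ := volume) (a₀ := 0) hf (s := fun z => z.1) (by fun_prop)
  refine (h1.sub h2).congr fun z => ?_
  exact intervalIntegral.integral_interval_sub_left
    ((continuous_rate hρ t _ _).intervalIntegrable _ _)
    ((continuous_rate hρ t _ _).intervalIntegrable _ _)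

lemma splitTime_spec (hρ : Continuous ρ) {b m E : ℝ} (hb : b ≤ t) (hE : E ≤ cumRate t ρ b m t) :
    splitTime t ρ b m E ∈ {r | r ∈ Icc b t ∧ E ≤ cumRate t ρ b m r} := by
  refine IsClosed.csInf_mem ?_ ⟨t, ⟨hb, le_rfl⟩, hE⟩ ⟨b, fun r hr => hr.1.1⟩
  exact isClosed_Icc.inter (isClosed_le continuous_const (continuous_cumRate hρ t b m))

/-- `splitTime` is the generalized inverse of the increasing continuous function `cumRate`; the
infimum is attained because the defining set is closed. -/
lemma splitTime_le_iff (hρ : Continuous ρ) (hpos : ∀ s, 0 < ρ s) {b m E s : ℝ} (hm : 0 ≤ m)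
    (hs : s ∈ Icc b t) (hE : E ≤ cumRate t ρ b m t) :
    splitTime t ρ b m E ≤ s ↔ E ≤ cumRate t ρ b m s := by
  have hspec := splitTime_spec hρ (hs.1.trans hs.2) hE
  constructor
  · intro h
    exact hspec.2.trans ((cumRate_strictMonoOn hρ hpos t b hm).monotoneOn hspec.1.1 hs.1 h)
  · exact fun h => csInf_le ⟨b, fun r hr => hr.1.1⟩ ⟨hs, h⟩

lemma splitTime_cumRate (hρ : Continuous ρ) (hpos : ∀ s, 0 < ρ s) {b m r : ℝ} (hm : 0 ≤ m)
    (hr : r ∈ Icc b t) : splitTime t ρ b m (cumRate t ρ b m r) = r := by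
  have hmono := cumRate_strictMonoOn hρ hpos t b hm
  have hE : cumRate t ρ b m r ≤ cumRate t ρ b m t :=
    hmono.monotoneOn hr.1 (hr.1.trans hr.2) hr.2
  have hspec := splitTime_spec hρ (hr.1.trans hr.2) hE
  refine le_antisymm ((splitTime_le_iff hρ hpos hm hr hE).2 le_rfl) ?_
  exact (hmono.le_iff_le hr.1 hspec.1.1).1 hspec.2

open Classical in
/-- The splitting time, set to `0` when there is no splitting before time `t`. -/
def clockTime (t : ℝ) (ρ : ℝ → ℝ) (b m E : ℝ) : ℝ :=
  if b ≤ t ∧ 0 ≤ m ∧ E ≤ cumRate t ρ b m t then splitTime t ρ b m E else 0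

lemma clockTime_of_le {b m E : ℝ} (hb : b ≤ t) (hm : 0 ≤ m) (hE : E ≤ cumRate t ρ b m t) :
    clockTime t ρ b m E = splitTime t ρ b m E := if_pos ⟨hb, hm, hE⟩

/-- The inverse relation rewrites `clockTime ≤ c` as an inequality for the jointly continuous
`cumRate`. It is only valid at times in `Icc b t`, whence the evaluation at `min c t`. -/
lemma measurable_clockTime (hρ : Continuous ρ) (hpos : ∀ s, 0 < ρ s) :
    Measurable fun z : ℝ × ℝ × ℝ => clockTime t ρ z.1 z.2.1 z.2.2 := by
  have hΛ : ∀ f : ℝ × ℝ × ℝ → ℝ, Measurable f →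
      Measurable fun z : ℝ × ℝ × ℝ => cumRate t ρ z.1 z.2.1 (f z) := fun f hf =>
    (continuous_cumRate_uncurry hρ t).measurable.comp
      (measurable_fst.prodMk (measurable_snd.fst.prodMk hf))
  have hD : MeasurableSet {z : ℝ × ℝ × ℝ | z.1 ≤ t ∧ 0 ≤ z.2.1 ∧
      z.2.2 ≤ cumRate t ρ z.1 z.2.1 t} :=
    (measurableSet_le measurable_fst measurable_const).inter
      ((measurableSet_le measurable_const measurable_snd.fst).inter
        (measurableSet_le measurable_snd.snd (hΛ _ measurable_const)))
  refine measurable_of_Iic fun c => ?_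
  have hset : (fun z : ℝ × ℝ × ℝ => clockTime t ρ z.1 z.2.1 z.2.2) ⁻¹' Iic c =
      ({z : ℝ × ℝ × ℝ | z.1 ≤ t ∧ 0 ≤ z.2.1 ∧ z.2.2 ≤ cumRate t ρ z.1 z.2.1 t} ∩
        ({z | z.1 ≤ c} ∩ {z | z.2.2 ≤ cumRate t ρ z.1 z.2.1 (min c t)})) ∪
      ({z : ℝ × ℝ × ℝ | z.1 ≤ t ∧ 0 ≤ z.2.1 ∧ z.2.2 ≤ cumRate t ρ z.1 z.2.1 t}ᶜ ∩
        {_z | (0 : ℝ) ≤ c}) := by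
    ext ⟨b, m, E⟩
    by_cases h : b ≤ t ∧ 0 ≤ m ∧ E ≤ cumRate t ρ b m t
    · have hspec := splitTime_spec hρ h.1 h.2.2
      have key : splitTime t ρ b m E ≤ c ↔ b ≤ c ∧ E ≤ cumRate t ρ b m (min c t) := by
        constructor
        · intro hc
          have hbc := hspec.1.1.trans hc
          exact ⟨hbc, (splitTime_le_iff hρ hpos h.2.1 ⟨le_min hbc h.1, min_le_right _ _⟩ h.2.2).1
            (le_min hc hspec.1.2)⟩
        · rintro ⟨hbc, hE⟩
          exact ((splitTime_le_iff hρ hpos h.2.1 ⟨le_min hbc h.1, min_le_right _ _⟩ h.2.2).2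
            hE).trans (min_le_left _ _)
      simp [clockTime, h, key]
    · have h0 : clockTime t ρ b m E = 0 := if_neg h
      simp [h0, h]
  rw [hset]
  refine (hD.inter ((measurableSet_le measurable_fst measurable_const).inter
    (measurableSet_le measurable_snd.snd (hΛ _ ?_)))).union (hD.compl.inter (MeasurableSet.const _))
  fun_prop

end Rate

/-! ### Paths of the branching process started at an arbitrary time -/

section BranchPath

variable {t : ℝ} {ρ : ℝ → ℝ} {α : Type*} [MeasurableSpace α]

open Classical in
/-- The mass of the particle `w` at time `s` in the system started at time `b` from a single
particle of mass `m`, the trajectory of this particle being extended linearly before time `b`. -/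
def branchMass (t : ℝ) (ρ : ℝ → ℝ) : Word → (Word → ℝ × I) → ℝ → ℝ → ℝ → Option ℝ
  | [], Z, b, m, s =>
    if cumRate t ρ b m t < (Z []).1 ∨ s < clockTime t ρ b m (Z []).1 then some (m - b + s) else none
  | i :: w, Z, b, m, s =>
    if cumRate t ρ b m t < (Z []).1 ∨ s < clockTime t ρ b m (Z []).1 then none else
      branchMass t ρ w (fun v => Z (i :: v)) (clockTime t ρ b m (Z []).1)
        (share i (Z []).2 * (m + (clockTime t ρ b m (Z []).1 - b))) s

/-- The path of the system of `branchMass`. -/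
def branchPath (t : ℝ) (ρ : ℝ → ℝ) (b m : ℝ) (Z : Word → ℝ × I) : Path t :=
  fun s w => branchMass t ρ w Z b m s

-- The branching property at the first splitting, as an identity between paths: each child runs the
-- same dynamics from the splitting time, driven by its own subfamily of the noise.
open Classical in
lemma branchPath_graft (b m : ℝ) (a : ℝ × I) (Z₀ Z₁ : Word → ℝ × I) :
    branchPath t ρ b m (graft a Z₀ Z₁) =
      if cumRate t ρ b m t < a.1 then linePath t (m - b) else
        splitPath (m - b) (clockTime t ρ b m a.1)
          (branchPath t ρ (clockTime t ρ b m a.1)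
            ((a.2 : ℝ) * (m + (clockTime t ρ b m a.1 - b))) Z₀)
          (branchPath t ρ (clockTime t ρ b m a.1)
            ((1 - a.2) * (m + (clockTime t ρ b m a.1 - b))) Z₁) := by
  ext1 s
  ext1 w
  by_cases h : cumRate t ρ b m t < a.1
  · match w with
    | [] => simp [branchPath, branchMass, h, linePath]
    | i :: w => simp [branchPath, branchMass, h, linePath]
  · by_cases hs : (s : ℝ) < clockTime t ρ b m a.1
    · match w with
      | [] => simp [branchPath, branchMass, h, linePath, splitPath, hs]
      | i :: w => simp [branchPath, branchMass, h, linePath, splitPath, hs]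
    · match w with
      | [] => simp [branchPath, branchMass, h, splitPath, hs]
      | i :: w =>
        fin_cases i <;> simp [branchPath, branchMass, h, splitPath, hs, share]

lemma measurable_cumRate_comp (hρ : Continuous ρ) {b m s : α → ℝ} (hb : Measurable b)
    (hm : Measurable m) (hs : Measurable s) : Measurable fun a => cumRate t ρ (b a) (m a) (s a) :=
  (continuous_cumRate_uncurry hρ t).measurable.comp (hb.prodMk (hm.prodMk hs))

lemma measurable_clockTime_comp (hρ : Continuous ρ) (hpos : ∀ s, 0 < ρ s) {b m E : α → ℝ}
    (hb : Measurable b) (hm : Measurable m) (hE : Measurable E) :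
    Measurable fun a => clockTime t ρ (b a) (m a) (E a) :=
  (measurable_clockTime hρ hpos).comp (hb.prodMk (hm.prodMk hE))

lemma measurable_share (i : Fin 2) : Measurable (share i) := by
  unfold share
  split_ifs <;> fun_prop

lemma measurable_branchMass (hρ : Continuous ρ) (hpos : ∀ s, 0 < ρ s) (w : Word) (s : ℝ)
    {b m : α → ℝ} {Z : α → Word → ℝ × I} (hb : Measurable b) (hm : Measurable m)
    (hZ : Measurable Z) : Measurable fun a => branchMass t ρ w (Z a) (b a) (m a) s := by
  induction w generalizing b m Z with
  | nil =>
    have hE : Measurable fun a => (Z a []).1 := by fun_prop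
    refine Measurable.ite ((measurableSet_lt (measurable_cumRate_comp hρ hb hm measurable_const)
      hE).union
      (measurableSet_lt measurable_const (measurable_clockTime_comp hρ hpos hb hm hE)))
      ?_ measurable_const
    exact measurable_some.comp ((hm.sub hb).add_const _)
  | cons i w ih =>
    have hE : Measurable fun a => (Z a []).1 := by fun_prop
    have hU : Measurable fun a => (Z a []).2 := by fun_prop
    have hr := measurable_clockTime_comp (t := t) hρ hpos hb hm hE
    refine Measurable.ite ((measurableSet_lt (measurable_cumRate_comp hρ hb hm measurable_const)
      hE).union
      (measurableSet_lt measurable_const hr)) measurable_const (ih hr ?_ (by fun_prop))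
    exact ((measurable_share i).comp hU).mul (hm.add (hr.sub hb))

lemma measurable_branchPath (hρ : Continuous ρ) (hpos : ∀ s, 0 < ρ s)
    {b m : α → ℝ} {Z : α → Word → ℝ × I} (hb : Measurable b) (hm : Measurable m)
    (hZ : Measurable Z) : Measurable fun a => branchPath t ρ (b a) (m a) (Z a) :=
  measurable_path fun s w => measurable_branchMass hρ hpos w s hb hm hZ

lemma share_nonneg (i : Fin 2) (U : I) : 0 ≤ share i U := by
  unfold share
  split_ifs
  · exact U.2.1
  · exact sub_nonneg.2 U.2.2

/-- From time `b` on, the linear extension before birth is invisible, and "not yet split at `s`"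
reads the same in terms of the clock and of the splitting time. -/
lemma branchMass_eq_branchingMass (hρ : Continuous ρ) (hpos : ∀ s, 0 < ρ s) (w : Word)
    (Z : Word → ℝ × I) {b m s : ℝ} (hm : 0 ≤ m) (hs : s ∈ Icc b t) :
    branchMass t ρ w Z b m s = branchingMass t ρ w Z b m s := by
  have hbt := hs.1.trans hs.2
  have hiff : ∀ (Z : Word → ℝ × I) (b m : ℝ), 0 ≤ m → s ∈ Icc b t →
      ((cumRate t ρ b m t < (Z []).1 ∨ s < clockTime t ρ b m (Z []).1) ↔
        ¬ (Z []).1 ≤ cumRate t ρ b m s) := by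
    intro Z b m hm hs
    by_cases h : (Z []).1 ≤ cumRate t ρ b m t
    · rw [clockTime_of_le (hs.1.trans hs.2) hm h, ← splitTime_le_iff hρ hpos hm hs h]
      simp [h]
    · have h' : ¬ (Z []).1 ≤ cumRate t ρ b m s := fun h' => h (h'.trans
        ((cumRate_strictMonoOn hρ hpos t b hm).monotoneOn hs.1 (hs.1.trans hs.2) hs.2))
      simp [h', not_le.1 h]
  induction w generalizing Z b m with
  | nil =>
    simp only [branchMass, branchingMass, hiff Z b m hm hs]
    by_cases h : (Z []).1 ≤ cumRate t ρ b m s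
    · simp [h]
    · simp only [h, not_false_eq_true, if_true, if_false, Option.some.injEq]
      ring
  | cons i w ih =>
    simp only [branchMass, branchingMass, hiff Z b m hm hs]
    by_cases h : (Z []).1 ≤ cumRate t ρ b m s
    · have hE : (Z []).1 ≤ cumRate t ρ b m t := h.trans
        ((cumRate_strictMonoOn hρ hpos t b hm).monotoneOn hs.1 hbt hs.2)
      have hspec := splitTime_spec hρ hbt hE
      have hle := (splitTime_le_iff hρ hpos hm hs hE).2 h
      rw [clockTime_of_le hbt hm hE]
      simp only [h, not_true_eq_false, if_true, if_false]
      exact ih _ (mul_nonneg (share_nonneg _ _) (by linarith [hspec.1.1])) ⟨hle, hs.2⟩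
        (hle.trans hs.2)
    · simp [h]

/-- `branchingMass` only depends on the values of the rate on `[0, ∞)`. -/
lemma branchingMass_congr {ρ' : ℝ → ℝ} (h : ∀ s, 0 ≤ s → ρ s = ρ' s) (ht : 0 ≤ t) (w : Word)
    (Z : Word → ℝ × I) {b s : ℝ} (m : ℝ) (hb : b ≤ t) (hs : s ≤ t) :
    branchingMass t ρ w Z b m s = branchingMass t ρ' w Z b m s := by
  have hc : ∀ b m r, b ≤ t → r ≤ t → cumRate t ρ b m r = cumRate t ρ' b m r := by
    intro b m r hb hr
    refine intervalIntegral.integral_congr fun x hx => ?_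
    have : x ≤ t := hx.2.trans (max_le hb hr)
    simp only [h (t - x) (by linarith)]
  have hT : ∀ b m E, b ≤ t → splitTime t ρ b m E = splitTime t ρ' b m E := by
    intro b m E hb
    unfold splitTime
    congr 1
    ext r
    refine and_congr_right fun hr => ?_
    rw [hc b m r hb hr.2]
  induction w generalizing Z b m with
  | nil => simp only [branchingMass, hc b m s hb hs]
  | cons i w ih =>
    simp only [branchingMass, hc b m s hb hs, hT b m _ hb]
    split_ifs with hE
    · refine ih _ _ ?_
      unfold splitTime
      rcases eq_empty_or_nonempty {r | r ∈ Icc b t ∧ (Z []).1 ≤ cumRate t ρ' b m r}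
        with h0 | ⟨r, hr⟩
      -- The infimum of the empty set is `0`, which is still at most `t`.
      · rw [h0, Real.sInf_empty]
        exact ht
      · exact (csInf_le ⟨b, fun r hr => hr.1.1⟩ hr).trans hr.1.2
    · rfl

end BranchPath

/-! ### Integration against exponential and uniform laws -/

instance : IsProbabilityMeasure (expMeasure 1) := isProbabilityMeasure_expMeasure one_pos

instance : IsProbabilityMeasure noise := by
  unfold noise
  infer_instance

lemma lintegral_expMeasure (r : ℝ) {h : ℝ → ℝ≥0∞} (hh : Measurable h) :
    ∫⁻ x, h x ∂(expMeasure r) =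
      ∫⁻ x in Ioi (0 : ℝ), ENNReal.ofReal (r * Real.exp (-(r * x))) * h x := by
  have hm : Measurable (exponentialPDF r) := (measurable_exponentialPDFReal r).ennreal_ofReal
  have h1 : expMeasure r = volume.withDensity (exponentialPDF r) := rfl
  rw [h1, lintegral_withDensity_eq_lintegral_mul _ hm hh, ← setLIntegral_congr Ioi_ae_eq_Ici.symm,
    ← lintegral_indicator measurableSet_Ici]
  refine lintegral_congr fun x => ?_
  by_cases hx : 0 ≤ x
  · simp [exponentialPDF_of_nonneg hx, hx]
  · simp [exponentialPDF_of_neg (not_le.1 hx), hx]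

lemma lintegral_exp_neg_Ioi (a : ℝ) :
    ∫⁻ x in Ioi a, ENNReal.ofReal (Real.exp (-x)) = ENNReal.ofReal (Real.exp (-a)) := by
  rw [← ofReal_integral_eq_lintegral_ofReal (integrableOn_exp_neg_Ioi a)
    (Filter.Eventually.of_forall fun x => (Real.exp_pos _).le), integral_exp_neg_Ioi]

/-- The substitution `y = u M`: the factor `M` of the splitting rate is the Jacobian turning a
uniform share into Lebesgue measure for the mass of the first child. -/
lemma mul_lintegral_unitInterval {M : ℝ} (hM : 0 < M) {G : ℝ → ℝ≥0∞} (hG : Measurable G) :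
    ENNReal.ofReal M * ∫⁻ u : I, G (u * M) = ∫⁻ y in Ioo 0 M, G y := by
  have h1 : ∫⁻ u : I, G (u * M) = ∫⁻ u in Ioo (0 : ℝ) 1, G (u * M) := by
    rw [setLIntegral_congr Ioo_ae_eq_Icc]
    exact (measurePreserving_subtype_coe measurableSet_Icc).lintegral_comp
      (hG.comp (measurable_id.mul_const M))
  have h2 : (fun u : ℝ => u * M) '' Ioo 0 1 = Ioo 0 M := by
    rw [image_mul_right_Ioo 0 1 hM, zero_mul, one_mul]
  rw [h1, ← h2, lintegral_image_eq_lintegral_abs_deriv_mul measurableSet_Ioo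
    (f' := fun _ => M) (fun x _ => by simpa using ((hasDerivAt_id x).mul_const M).hasDerivWithinAt)
    (fun x _ y _ h => mul_right_cancel₀ hM.ne' h), lintegral_const_mul']
  · rw [abs_of_pos hM]
  · exact ENNReal.ofReal_ne_top

/-! ### Decomposition of the branching process at its first splitting time -/

section FirstSplit

variable {t : ℝ} {ρ : ℝ → ℝ} {α : Type*} [MeasurableSpace α]

/-- The expectation of `ψ` for the branching process started at time `b` from a mass `m`. -/
def meanBranch (t : ℝ) (ρ : ℝ → ℝ) (ψ : Path t → ℝ≥0∞) (b m : ℝ) : ℝ≥0∞ :=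
  ∫⁻ Z, ψ (branchPath t ρ b m Z) ∂noise

/-- The expectation of `ψ` for a particle on the line with intercept `c` that splits at time `r`
into two particles of masses `y₀` and `y₁`. -/
def meanSplit (t : ℝ) (ρ : ℝ → ℝ) (ψ : Path t → ℝ≥0∞) (c r y₀ y₁ : ℝ) : ℝ≥0∞ :=
  ∫⁻ Z₀, ∫⁻ Z₁, ψ (splitPath c r (branchPath t ρ r y₀ Z₀) (branchPath t ρ r y₁ Z₁)) ∂noise ∂noise

lemma measurable_meanBranch (hρ : Continuous ρ) (hpos : ∀ s, 0 < ρ s) {ψ : α → Path t → ℝ≥0∞}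
    (hψ : Measurable (Function.uncurry ψ)) {b m : α → ℝ} (hb : Measurable b) (hm : Measurable m) :
    Measurable fun a => meanBranch t ρ (ψ a) (b a) (m a) := by
  refine Measurable.lintegral_prod_right' (f := fun z : α × (Word → ℝ × I) =>
    ψ z.1 (branchPath t ρ (b z.1) (m z.1) z.2)) ?_
  exact hψ.comp (measurable_fst.prodMk
    (measurable_branchPath hρ hpos (by fun_prop) (by fun_prop) measurable_snd))

lemma measurable_meanSplit (hρ : Continuous ρ) (hpos : ∀ s, 0 < ρ s) {ψ : α → Path t → ℝ≥0∞}
    (hψ : Measurable (Function.uncurry ψ)) {c r y₀ y₁ : α → ℝ} (hc : Measurable c)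
    (hr : Measurable r) (h₀ : Measurable y₀) (h₁ : Measurable y₁) :
    Measurable fun a => meanSplit t ρ (ψ a) (c a) (r a) (y₀ a) (y₁ a) := by
  refine Measurable.lintegral_prod_right' (f := fun z : α × (Word → ℝ × I) =>
    ∫⁻ Z₁, ψ z.1 (splitPath (c z.1) (r z.1) (branchPath t ρ (r z.1) (y₀ z.1) z.2)
      (branchPath t ρ (r z.1) (y₁ z.1) Z₁)) ∂noise) ?_
  refine Measurable.lintegral_prod_right' (f := fun z : (α × (Word → ℝ × I)) × (Word → ℝ × I) =>
    ψ z.1.1 (splitPath (c z.1.1) (r z.1.1) (branchPath t ρ (r z.1.1) (y₀ z.1.1) z.1.2)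
      (branchPath t ρ (r z.1.1) (y₁ z.1.1) z.2))) ?_
  exact hψ.comp ((by fun_prop : Measurable fun z : (α × (Word → ℝ × I)) × (Word → ℝ × I) =>
    z.1.1).prodMk (measurable_splitPath (by fun_prop) (by fun_prop)
    (measurable_branchPath hρ hpos (by fun_prop) (by fun_prop) (by fun_prop))
    (measurable_branchPath hρ hpos (by fun_prop) (by fun_prop) (by fun_prop))))

open Classical in
lemma meanBranch_eq_lintegral_clock (hρ : Continuous ρ) (hpos : ∀ s, 0 < ρ s)
    {ψ : Path t → ℝ≥0∞} (hψ : Measurable ψ) (b m : ℝ) :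
    meanBranch t ρ ψ b m = ∫⁻ E, (if cumRate t ρ b m t < E then ψ (linePath t (m - b)) else
      ∫⁻ u : I, meanSplit t ρ ψ (m - b) (clockTime t ρ b m E)
        (u * (m + (clockTime t ρ b m E - b))) ((1 - u) * (m + (clockTime t ρ b m E - b))))
      ∂(expMeasure 1) := by
  have hmeas : Measurable fun Z => ψ (branchPath t ρ b m Z) :=
    hψ.comp (measurable_branchPath hρ hpos measurable_const measurable_const measurable_id)
  unfold meanBranch
  have hn : noise = Measure.infinitePi fun _ : Word => (expMeasure 1).prod (volume : Measure I) :=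
    rfl
  rw [hn, lintegral_infinitePi_word _ hmeas, ← hn]
  have h1 : ∀ a : ℝ × I, ∫⁻ Z₀, ∫⁻ Z₁, ψ (branchPath t ρ b m (graft a Z₀ Z₁)) ∂noise ∂noise =
      if cumRate t ρ b m t < a.1 then ψ (linePath t (m - b)) else
      meanSplit t ρ ψ (m - b) (clockTime t ρ b m a.1)
        (a.2 * (m + (clockTime t ρ b m a.1 - b)))
        ((1 - a.2) * (m + (clockTime t ρ b m a.1 - b))) := by
    intro a
    simp only [branchPath_graft]
    by_cases h : cumRate t ρ b m t < a.1
    · simp [h]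
    · simp only [h, if_false, meanSplit]
  simp only [h1]
  have hcl : Measurable fun a : ℝ × I => clockTime t ρ b m a.1 :=
    measurable_clockTime_comp hρ hpos measurable_const measurable_const measurable_fst
  rw [lintegral_prod]
  · refine lintegral_congr fun E => ?_
    by_cases h : cumRate t ρ b m t < E
    · simp [h]
    · simp only [h, if_false]
  · refine (Measurable.ite (measurableSet_lt measurable_const measurable_fst) measurable_const
      (measurable_meanSplit (ψ := fun _ => ψ) hρ hpos (hψ.comp measurable_snd) measurable_const hcl
        ?_ ?_)).aemeasurable
    · fun_prop
    · fun_prop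

/-- The substitution `E = cumRate t ρ b m r`: an exponential clock gives the splitting time the
density rate times `exp (-cumRate)`. -/
lemma lintegral_clock (hρ : Continuous ρ) (hpos : ∀ s, 0 < ρ s) {b m : ℝ} (hb : b ≤ t)
    (hm : 0 ≤ m) (G : ℝ → ℝ≥0∞) :
    ∫⁻ E in Ioc 0 (cumRate t ρ b m t), ENNReal.ofReal (Real.exp (-E)) * G (clockTime t ρ b m E) =
      ∫⁻ r in Ioc b t, ENNReal.ofReal (ρ (t - r) * (m + (r - b)) *
        Real.exp (-cumRate t ρ b m r)) * G r := by
  have hmono := cumRate_strictMonoOn hρ hpos t b hm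
  have himage : cumRate t ρ b m '' Ioc b t = Ioc 0 (cumRate t ρ b m t) := by
    refine Subset.antisymm ?_ ?_
    · rintro _ ⟨r, hr, rfl⟩
      rw [← cumRate_self (t := t) (ρ := ρ) b m]
      exact ⟨hmono self_mem_Ici hr.1.le hr.1, hmono.monotoneOn hr.1.le hb hr.2⟩
    · have := intermediate_value_Ioc hb (continuous_cumRate hρ t b m).continuousOn
      rwa [cumRate_self] at this
  rw [← himage, lintegral_image_eq_lintegral_abs_deriv_mul measurableSet_Ioc
    (fun r _ => (hasDerivAt_cumRate hρ t b m r).hasDerivWithinAt)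
    (hmono.injOn.mono fun r hr => hr.1.le)]
  refine setLIntegral_congr_fun measurableSet_Ioc fun r hr => ?_
  have hr0 : 0 ≤ ρ (t - r) * (m + (r - b)) :=
    mul_nonneg (hpos _).le (by linarith [hr.1])
  rw [clockTime_of_le hb hm (hmono.monotoneOn hr.1.le hb hr.2),
    splitTime_cumRate hρ hpos hm ⟨hr.1.le, hr.2⟩, abs_of_nonneg hr0, ← mul_assoc,
    ← ENNReal.ofReal_mul hr0]

/-- The factor `m + (r - b)` of the rate is absorbed into the unnormalized integral over the mass
`y` of the first child, the form in which it can be compared with pairs of independent children. -/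
lemma meanBranch_firstSplit (hρ : Continuous ρ) (hpos : ∀ s, 0 < ρ s)
    {ψ : Path t → ℝ≥0∞} (hψ : Measurable ψ) {b m : ℝ} (hb : b ≤ t) (hm : 0 < m) :
    meanBranch t ρ ψ b m =
      ENNReal.ofReal (Real.exp (-cumRate t ρ b m t)) * ψ (linePath t (m - b)) +
      ∫⁻ r in Ioc b t, ENNReal.ofReal (ρ (t - r) * Real.exp (-cumRate t ρ b m r)) *
        ∫⁻ y in Ioo 0 (m + (r - b)), meanSplit t ρ ψ (m - b) r y (m + (r - b) - y) := by
  classical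
  set G : ℝ → ℝ≥0∞ := fun r => ∫⁻ u : I, meanSplit t ρ ψ (m - b) r
    (u * (m + (r - b))) ((1 - u) * (m + (r - b))) with hG
  have hGm : Measurable G := by
    refine Measurable.lintegral_prod_right' (f := fun z : ℝ × I => meanSplit t ρ ψ (m - b) z.1
      (z.2 * (m + (z.1 - b))) ((1 - z.2) * (m + (z.1 - b)))) ?_
    exact measurable_meanSplit (ψ := fun _ => ψ) hρ hpos (hψ.comp measurable_snd)
      measurable_const measurable_fst
      (by fun_prop) (by fun_prop)
  have hcl : Measurable fun E => clockTime t ρ b m E :=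
    measurable_clockTime_comp hρ hpos measurable_const measurable_const measurable_id
  have hΛ : 0 ≤ cumRate t ρ b m t := by
    rw [← cumRate_self (t := t) (ρ := ρ) b m]
    exact (cumRate_strictMonoOn hρ hpos t b hm.le).monotoneOn self_mem_Ici hb hb
  have hGc : Measurable fun E => if cumRate t ρ b m t < E then ψ (linePath t (m - b)) else
      G (clockTime t ρ b m E) :=
    Measurable.ite measurableSet_Ioi measurable_const (hGm.comp hcl)
  rw [meanBranch_eq_lintegral_clock hρ hpos hψ, lintegral_expMeasure 1 hGc,
    ← Ioc_union_Ioi_eq_Ioi hΛ, lintegral_union measurableSet_Ioi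
      (Ioc_disjoint_Ioi le_rfl), add_comm]
  congr 1
  · rw [setLIntegral_congr_fun (g := fun E => ENNReal.ofReal (Real.exp (-E)) *
      ψ (linePath t (m - b))) measurableSet_Ioi fun E hE => ?_]
    · rw [lintegral_mul_const _ (by fun_prop), lintegral_exp_neg_Ioi]
    · simp only [if_pos (show cumRate t ρ b m t < E from hE), one_mul]
  · rw [setLIntegral_congr_fun (g := fun E => ENNReal.ofReal (Real.exp (-E)) *
      G (clockTime t ρ b m E)) measurableSet_Ioc fun E hE => ?_]
    · rw [lintegral_clock hρ hpos hb hm.le]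
      refine setLIntegral_congr_fun measurableSet_Ioc fun r hr => ?_
      have hM : 0 < m + (r - b) := by linarith [hr.1]
      rw [← mul_lintegral_unitInterval hM, ← mul_assoc, ← ENNReal.ofReal_mul
        (mul_nonneg (hpos _).le (Real.exp_pos _).le)]
      · congr 1
        · congr 1
          ring
        · refine lintegral_congr fun u => ?_
          congr 1
          ring
      · exact measurable_meanSplit (ψ := fun _ => ψ) hρ hpos (hψ.comp measurable_snd)
          measurable_const
          measurable_const measurable_id (by fun_prop)
    · simp only [if_neg (not_lt.2 hE.2), one_mul, hG]

end FirstSplit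

/-! ### The differential system -/

lemma hasDerivAt_exp_integral {k : ℝ → ℝ} (hk : Continuous k) (a s : ℝ) :
    HasDerivAt (fun x => Real.exp (∫ y in a..x, k y)) (Real.exp (∫ y in a..s, k y) * k s) s :=
  (intervalIntegral.integral_hasDerivAt_right (hk.intervalIntegrable _ _)
    (hk.stronglyMeasurableAtFilter _ _) hk.continuousAt).exp

/-- Integrating factor: `y` times `exp (-∫ k)` is nondecreasing. This keeps the differential system
in its state space. -/
lemma mul_exp_integral_le {k y y' : ℝ → ℝ} (hk : Continuous k)
    (hy : ∀ s, 0 ≤ s → HasDerivWithinAt y (y' s) (Ici 0) s)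
    (hle : ∀ s, 0 ≤ s → k s * y s ≤ y' s) {s : ℝ} (hs : 0 ≤ s) :
    y 0 * Real.exp (∫ x in (0 : ℝ)..s, k x) ≤ y s := by
  have hd : ∀ x, 0 < x → HasDerivAt (fun x => y x * Real.exp (∫ z in (0 : ℝ)..x, (-k) z))
      (y' x * Real.exp (∫ z in (0 : ℝ)..x, (-k) z) +
        y x * (Real.exp (∫ z in (0 : ℝ)..x, (-k) z) * (-k) x)) x := fun x hx =>
    ((hy x hx.le).hasDerivAt (Ici_mem_nhds hx)).mul (hasDerivAt_exp_integral hk.neg 0 x)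
  have hmono : MonotoneOn (fun x => y x * Real.exp (∫ z in (0 : ℝ)..x, (-k) z)) (Ici 0) := by
    refine monotoneOn_of_deriv_nonneg (convex_Ici 0) ?_ ?_ ?_
    · exact ContinuousOn.mul (fun x hx => (hy x hx).continuousWithinAt)
        fun x _ => (hasDerivAt_exp_integral hk.neg 0 x).continuousAt.continuousWithinAt
    · rw [interior_Ici]
      exact fun x hx => (hd x hx).differentiableAt.differentiableWithinAt
    · rw [interior_Ici]
      intro x hx
      rw [(hd x hx).deriv, Pi.neg_apply]
      have := hle x (le_of_lt hx)
      have he := Real.exp_pos (∫ z in (0 : ℝ)..x, (-k) z)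
      nlinarith
  have h := hmono self_mem_Ici hs hs
  simp only [intervalIntegral.integral_same, Real.exp_zero, mul_one, Pi.neg_apply,
    intervalIntegral.integral_neg, Real.exp_neg] at h
  rwa [← div_eq_mul_inv, le_div_iff₀ (Real.exp_pos _)] at h

/-- Solutions of the differential system on `[0, ∞)`, extended to continuous functions on `ℝ` with
values in the state space. -/
structure IsFlow (p lam : ℝ → ℝ) : Prop where
  continuous_p : Continuous p
  continuous_lam : Continuous lam
  hasDerivAt_p : ∀ s, 0 < s → HasDerivAt p ((1 - p s) * (lam s - p s)) s
  hasDerivAt_lam : ∀ s, 0 < s → HasDerivAt lam (-lam s * (1 - p s)) s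
  p_nonneg : ∀ s, 0 ≤ p s
  p_lt_one : ∀ s, p s < 1
  lam_pos : ∀ s, 0 < lam s

/-- Freezing the solution at negative times makes the rate continuous and positive on the whole
line. Along the solution, `1 - p` and `λ` satisfy linear homogeneous equations and so stay positive;
then `p' ≥ -(1 - p) p` keeps `p` nonnegative. -/
lemma isFlow_extend {p lam : ℝ → ℝ} (hp0 : p 0 ∈ Ico (0 : ℝ) 1) (hlam0 : 0 < lam 0)
    (hp : ∀ s, 0 ≤ s → HasDerivWithinAt p ((1 - p s) * (lam s - p s)) (Ici 0) s)
    (hlam : ∀ s, 0 ≤ s → HasDerivWithinAt lam (-lam s * (1 - p s)) (Ici 0) s) :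
    IsFlow (fun s => p (max s 0)) (fun s => lam (max s 0)) := by
  have hpc : Continuous fun s => p (max s 0) :=
    ContinuousOn.comp_continuous (s := Ici 0) (fun x hx => (hp x hx).continuousWithinAt)
      (by fun_prop) fun x => mem_Ici.2 (le_max_right x 0)
  have hlc : Continuous fun s => lam (max s 0) :=
    ContinuousOn.comp_continuous (s := Ici 0) (fun x hx => (hlam x hx).continuousWithinAt)
      (by fun_prop) fun x => mem_Ici.2 (le_max_right x 0)
  have hp1 : ∀ s, 0 ≤ s → p s < 1 := by
    intro s hs
    have h := mul_exp_integral_le (y := fun x => 1 - p x)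
      (k := fun x => -(lam (max x 0) - p (max x 0))) (hlc.sub hpc).neg
      (fun x hx => (hp x hx).const_sub 1)
      (fun x hx => by rw [max_eq_left hx]; exact le_of_eq (by ring)) hs
    linarith [mul_pos (sub_pos.2 hp0.2) (Real.exp_pos
      (∫ x in (0 : ℝ)..s, -(lam (max x 0) - p (max x 0))))]
  have hl0 : ∀ s, 0 ≤ s → 0 < lam s := by
    intro s hs
    have h := mul_exp_integral_le (y := lam)
      (k := fun x => -(1 - p (max x 0))) (continuous_const.sub hpc).neg hlam
      (fun x hx => by rw [max_eq_left hx]; exact le_of_eq (by ring)) hs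
    exact (mul_pos hlam0 (Real.exp_pos _)).trans_le h
  have hpn : ∀ s, 0 ≤ s → 0 ≤ p s := by
    intro s hs
    refine le_trans (mul_nonneg hp0.1 (Real.exp_pos _).le) (mul_exp_integral_le (y := p)
      (k := fun x => -(1 - p (max x 0))) (continuous_const.sub hpc).neg hp
      (fun x hx => ?_) hs)
    rw [max_eq_left hx]
    nlinarith [mul_pos (sub_pos.2 (hp1 x hx)) (hl0 x hx)]
  have hev : ∀ s : ℝ, 0 < s → ∀ f : ℝ → ℝ, (fun x => f (max x 0)) =ᶠ[nhds s] f := by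
    intro s hs f
    filter_upwards [Ioi_mem_nhds hs] with x hx
    rw [max_eq_left (le_of_lt hx)]
  refine ⟨hpc, hlc, fun s hs => ?_, fun s hs => ?_, fun s => hpn _ (le_max_right _ _),
    fun s => hp1 _ (le_max_right _ _), fun s => hl0 _ (le_max_right _ _)⟩
  · rw [max_eq_left hs.le]
    exact ((hp s hs.le).hasDerivAt (Ici_mem_nhds hs)).congr_of_eventuallyEq (hev s hs p)
  · rw [max_eq_left hs.le]
    exact ((hlam s hs.le).hasDerivAt (Ici_mem_nhds hs)).congr_of_eventuallyEq (hev s hs lam)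

/-- The rate function `(1 - p) λ`. -/
def rateOf (p lam : ℝ → ℝ) (s : ℝ) : ℝ := (1 - p s) * lam s

section Flow

variable {p lam : ℝ → ℝ}

lemma IsFlow.continuous_rateOf (hf : IsFlow p lam) : Continuous (rateOf p lam) :=
  (continuous_const.sub hf.continuous_p).mul hf.continuous_lam

lemma IsFlow.rateOf_pos (hf : IsFlow p lam) (s : ℝ) : 0 < rateOf p lam s :=
  mul_pos (sub_pos.2 (hf.p_lt_one s)) (hf.lam_pos s)

lemma IsFlow.hasDerivAt_rateOf (hf : IsFlow p lam) {s : ℝ} (hs : 0 < s) :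
    HasDerivAt (rateOf p lam) (-rateOf p lam s * (lam s + 1 - 2 * p s)) s := by
  refine (((hf.hasDerivAt_p s hs).const_sub 1).mul (hf.hasDerivAt_lam s hs)).congr_deriv ?_
  unfold rateOf
  ring

/-- Evolution of the density `(1 - p) λ e^{-λ x}` along the lines of slope `1`. -/
lemma IsFlow.density_mul_exp_cumRate (hf : IsFlow p lam) {t c q r : ℝ} (hqr : q ≤ r) (hr : r ≤ t) :
    rateOf p lam (t - q) * Real.exp (-(lam (t - q) * (c + q))) *
        Real.exp (-cumRate t (rateOf p lam) q (c + q) r) =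
      Real.exp (-(r - q)) * Real.exp (∫ x in q..r, 2 * p (t - x)) *
        (rateOf p lam (t - r) * Real.exp (-(lam (t - r) * (c + r)))) := by
  have hρ := hf.continuous_rateOf
  have hp := hf.continuous_p
  have hl := hf.continuous_lam
  -- Minus the logarithmic derivative of `G` below: since `λ' = -ρ` and `ρ' = -ρ (λ + 1 - 2 p)`, the
  -- two occurrences of `λ` alone cancel.
  set k : ℝ → ℝ := fun x => rateOf p lam (t - x) * (c + x) + 2 * p (t - x) - 1 with hk
  have hkc : Continuous k := by fun_prop
  set G : ℝ → ℝ := fun x => rateOf p lam (t - x) * Real.exp (-(lam (t - x) * (c + x))) with hG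
  have hGc : Continuous G := by fun_prop
  have hGd : ∀ x, x < t → HasDerivAt G (-(G x * k x)) x := by
    intro x hx
    have hx0 : 0 < t - x := sub_pos.2 hx
    have h1 := (hf.hasDerivAt_rateOf hx0).comp_const_sub t x
    have h2 := (hf.hasDerivAt_lam _ hx0).comp_const_sub t x
    refine (h1.mul (h2.mul ((hasDerivAt_id x).const_add c)).neg.exp).congr_deriv ?_
    simp only [hG, hk, id_eq, Pi.neg_apply, Pi.mul_apply, rateOf]
    ring
  -- Derivatives are only needed on `[q, r)`, which avoids the time `t`, where `t - x = 0` and the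
  -- frozen flow need not be differentiable.
  have hconst := constant_of_has_deriv_right_zero
    (f := fun x => G x * Real.exp (∫ y in q..x, k y)) (a := q) (b := r)
    (hGc.mul (continuous_iff_continuousAt.2 fun x =>
      (hasDerivAt_exp_integral hkc q x).continuousAt)).continuousOn
    (fun x hx => (((hGd x (hx.2.trans_le hr)).mul (hasDerivAt_exp_integral hkc q x)).congr_deriv
      (by ring)).hasDerivWithinAt) r ⟨hqr, le_rfl⟩
  simp only [intervalIntegral.integral_same, Real.exp_zero, mul_one] at hconst
  have hint : ∫ y in q..r, k y = cumRate t (rateOf p lam) q (c + q) r +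
      (∫ x in q..r, 2 * p (t - x)) - (r - q) := by
    have h1 : Continuous fun x => rateOf p lam (t - x) * (c + x) := by fun_prop
    have h2 : Continuous fun x => 2 * p (t - x) := by fun_prop
    have h3 := intervalIntegral.integral_add (μ := volume) (h1.intervalIntegrable q r)
      (h2.intervalIntegrable q r)
    have h4 := intervalIntegral.integral_sub (μ := volume) ((h1.add h2).intervalIntegrable q r)
      (continuous_const (y := (1 : ℝ)).intervalIntegrable q r)
    have h5 : cumRate t (rateOf p lam) q (c + q) r =
        ∫ x in q..r, rateOf p lam (t - x) * (c + x) := by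
      unfold cumRate
      congr 1
      ext x
      ring
    rw [h5, ← h3, ← (show ∫ _ in q..r, (1 : ℝ) = r - q by simp)]
    exact h4
  change G q * _ = _ * G r
  rw [← hconst, hint, mul_assoc, ← Real.exp_add, mul_comm (_ * _) (G r), ← Real.exp_add]
  congr 2
  ring

end Flow

/-! ### A linear integral equation -/

lemma lintegral_triangle_swap (b t : ℝ) {F : ℝ → ℝ → ℝ≥0∞}
    (hF : Measurable (Function.uncurry F)) :
    ∫⁻ q in Ioc b t, ∫⁻ r in Ioc q t, F q r = ∫⁻ r in Ioc b t, ∫⁻ q in Ioc b r, F q r := by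
  set D : Set (ℝ × ℝ) := {z | z.1 < z.2} with hD
  have hDm : MeasurableSet D := measurableSet_lt measurable_fst measurable_snd
  have h1 : ∀ q ∈ Ioc b t, ∫⁻ r in Ioc q t, F q r =
      ∫⁻ r in Ioc b t, D.indicator (Function.uncurry F) (q, r) := by
    intro q hq
    rw [← lintegral_indicator measurableSet_Ioc, ← lintegral_indicator measurableSet_Ioc]
    refine lintegral_congr fun r => ?_
    by_cases hqr : q < r
    · have : r ∈ Ioc q t ↔ r ∈ Ioc b t := by
        simp only [mem_Ioc, hqr, true_and, hq.1.trans hqr]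
      by_cases hr : r ∈ Ioc b t
      · simp [hr, this.2 hr, indicator, hD, hqr, -mem_Ioc]
      · simp [hr, mt this.1 hr, -mem_Ioc]
    · simp [indicator, hD, hqr]
  have h2 : ∀ r ∈ Ioc b t, ∫⁻ q in Ioc b r, F q r =
      ∫⁻ q in Ioc b t, D.indicator (Function.uncurry F) (q, r) := by
    intro r hr
    rw [← setLIntegral_congr Ioo_ae_eq_Ioc, ← lintegral_indicator measurableSet_Ioo,
      ← lintegral_indicator measurableSet_Ioc]
    refine lintegral_congr fun q => ?_
    by_cases hqr : q < r
    · have : q ∈ Ioo b r ↔ q ∈ Ioc b t := by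
        simp only [mem_Ioo, mem_Ioc, hqr, and_true, (hqr.trans_le hr.2).le]
      by_cases hq : q ∈ Ioc b t
      · simp [hq, this.2 hq, indicator, hD, hqr, -mem_Ioc, -mem_Ioo]
      · simp [hq, mt this.1 hq, -mem_Ioc, -mem_Ioo]
    · simp [indicator, hD, hqr]
  rw [setLIntegral_congr_fun measurableSet_Ioc h1, setLIntegral_congr_fun measurableSet_Ioc h2]
  exact lintegral_lintegral_swap (hF.indicator hDm).aemeasurable

/-- The integrand is the derivative in `q` of `-exp (∫ x in q..r, h x)`. -/
lemma lintegral_mul_exp_integral {h : ℝ → ℝ} (hh : Continuous h) (h0 : ∀ x, 0 ≤ h x) {b r : ℝ}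
    (hbr : b ≤ r) :
    ∫⁻ q in Ioc b r, ENNReal.ofReal (h q * Real.exp (∫ x in q..r, h x)) =
      ENNReal.ofReal (Real.exp (∫ x in b..r, h x) - 1) := by
  have hd : ∀ q, HasDerivAt (fun q => -Real.exp (∫ x in q..r, h x))
      (h q * Real.exp (∫ x in q..r, h x)) q := by
    intro q
    refine (intervalIntegral.integral_hasDerivAt_left (hh.intervalIntegrable _ _)
      (hh.stronglyMeasurableAtFilter _ _) hh.continuousAt).exp.neg.congr_deriv ?_
    ring
  have hc : Continuous fun q => h q * Real.exp (∫ x in q..r, h x) := by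
    refine hh.mul ?_
    have : Continuous fun q => -Real.exp (∫ x in q..r, h x) :=
      continuous_iff_continuousAt.2 fun q => (hd q).continuousAt
    exact this.neg.congr fun q => neg_neg _
  rw [← ofReal_integral_eq_lintegral_ofReal (hc.integrableOn_Ioc)
    (Filter.Eventually.of_forall fun q => mul_nonneg (h0 q) (Real.exp_pos _).le),
    ← intervalIntegral.integral_of_le hbr,
    intervalIntegral.integral_eq_sub_of_hasDerivAt (fun q _ => hd q) (hc.intervalIntegrable _ _)]
  congr 1
  simp
  ring

lemma continuous_integral_uncurry {h : ℝ → ℝ} (hh : Continuous h) :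
    Continuous fun z : ℝ × ℝ => ∫ x in z.1..z.2, h x := by
  have hp : Continuous fun s => ∫ x in (0 : ℝ)..s, h x :=
    continuous_iff_continuousAt.2 fun s => (intervalIntegral.integral_hasDerivAt_right
      (hh.intervalIntegrable _ _) (hh.stronglyMeasurableAtFilter _ _)
      hh.continuousAt).continuousAt
  refine ((hp.comp continuous_snd).sub (hp.comp continuous_fst)).congr fun z => ?_
  exact intervalIntegral.integral_interval_sub_left (hh.intervalIntegrable _ _)
    (hh.intervalIntegrable _ _)

/-- The factor `exp (∫ h)` in `ha` accounts for any number of intermediate events of rate `h`; the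
conclusion isolates the first one. Insert `ha` into the term with `h r * a r` and exchange the
integrals: `h q * exp (∫ x in q..r, h x)` integrates to `exp (∫ x in b..r, h x) - 1`, the weight of
at least one event, and the remaining terms supply the missing `1`. Nonnegativity makes
integrability assumptions on `a` and `v` unnecessary. -/
lemma volterra_of_resolvent {h : ℝ → ℝ} (hh : Continuous h) (h0 : ∀ x, 0 ≤ h x) {b t : ℝ}
    (hbt : b ≤ t) {a v : ℝ → ℝ≥0∞} (hv : Measurable v) (K : ℝ≥0∞)
    (ha : ∀ q ∈ Icc b t, a q =
      ENNReal.ofReal (Real.exp (-(t - q)) * Real.exp (∫ x in q..t, h x)) * K +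
      ∫⁻ r in Ioc q t, ENNReal.ofReal (Real.exp (-(r - q)) * Real.exp (∫ x in q..r, h x)) * v r) :
    a b = ENNReal.ofReal (Real.exp (-(t - b))) * K +
      ∫⁻ r in Ioc b t, ENNReal.ofReal (Real.exp (-(r - b))) *
        (ENNReal.ofReal (h r) * a r + v r) := by
  have hH := continuous_integral_uncurry hh
  have hHr : ∀ r, Continuous fun q => ∫ x in q..r, h x := fun r =>
    hH.comp (continuous_id.prodMk continuous_const)
  have h1 : ∀ r, b ≤ r → 0 ≤ Real.exp (∫ x in b..r, h x) - 1 := fun r hr => by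
    have : 0 ≤ ∫ x in b..r, h x := intervalIntegral.integral_nonneg hr fun x _ => h0 x
    linarith [Real.add_one_le_exp (∫ x in b..r, h x)]
  have hsplit : ∀ q ∈ Ioc b t, ENNReal.ofReal (Real.exp (-(q - b))) * (ENNReal.ofReal (h q) * a q) =
      ENNReal.ofReal (h q * Real.exp (∫ x in q..t, h x)) *
        (ENNReal.ofReal (Real.exp (-(t - b))) * K) +
      ∫⁻ r in Ioc q t, ENNReal.ofReal (h q * Real.exp (∫ x in q..r, h x)) *
        (ENNReal.ofReal (Real.exp (-(r - b))) * v r) := by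
    intro q hq
    have hcomb : ∀ r, ENNReal.ofReal (Real.exp (-(q - b))) * (ENNReal.ofReal (h q) *
        ENNReal.ofReal (Real.exp (-(r - q)) * Real.exp (∫ x in q..r, h x))) =
        ENNReal.ofReal (h q * Real.exp (∫ x in q..r, h x)) *
          ENNReal.ofReal (Real.exp (-(r - b))) := by
      intro r
      rw [← ENNReal.ofReal_mul (h0 q), ← ENNReal.ofReal_mul (Real.exp_pos _).le,
        ← ENNReal.ofReal_mul (mul_nonneg (h0 q) (Real.exp_pos _).le)]
      congr 1
      rw [show -(r - b) = -(q - b) + -(r - q) by ring, Real.exp_add]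
      ring
    rw [ha q ⟨hq.1.le, hq.2⟩, mul_add, mul_add, ← mul_assoc, ← mul_assoc, mul_assoc (_ : ℝ≥0∞) _
      (ENNReal.ofReal (_ * _)), hcomb t, mul_assoc]
    congr 1
    rw [← lintegral_const_mul' _ _ ENNReal.ofReal_ne_top,
      ← lintegral_const_mul' _ _ ENNReal.ofReal_ne_top]
    refine lintegral_congr fun r => ?_
    rw [← mul_assoc (ENNReal.ofReal (h q)), ← mul_assoc, hcomb r, mul_assoc]
  have hm1 : Measurable fun r => ENNReal.ofReal (Real.exp (-(r - b))) * v r := by fun_prop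
  have hF : Measurable (Function.uncurry fun q r =>
      ENNReal.ofReal (h q * Real.exp (∫ x in q..r, h x)) *
        (ENNReal.ofReal (Real.exp (-(r - b))) * v r)) := by
    refine Measurable.mul (Measurable.ennreal_ofReal ?_) (hm1.comp measurable_snd)
    exact ((hh.comp continuous_fst).mul (Real.continuous_exp.comp hH)).measurable
  have hm3 : ∀ r, Measurable fun q => ENNReal.ofReal (h q * Real.exp (∫ x in q..r, h x)) :=
    fun r => (hh.mul (Real.continuous_exp.comp (hHr r))).measurable.ennreal_ofReal
  have hm2 : Measurable fun q => ENNReal.ofReal (h q * Real.exp (∫ x in q..t, h x)) *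
      (ENNReal.ofReal (Real.exp (-(t - b))) * K) := (hm3 t).mul_const _
  have hmain : ∫⁻ q in Ioc b t, ENNReal.ofReal (Real.exp (-(q - b))) *
      (ENNReal.ofReal (h q) * a q) =
      ENNReal.ofReal (Real.exp (∫ x in b..t, h x) - 1) *
        (ENNReal.ofReal (Real.exp (-(t - b))) * K) +
      ∫⁻ r in Ioc b t, ENNReal.ofReal (Real.exp (∫ x in b..r, h x) - 1) *
        (ENNReal.ofReal (Real.exp (-(r - b))) * v r) := by
    rw [setLIntegral_congr_fun measurableSet_Ioc hsplit, lintegral_add_left hm2,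
      lintegral_triangle_swap b t hF, lintegral_mul_const _ (hm3 t),
      lintegral_mul_exp_integral hh h0 hbt]
    congr 1
    refine setLIntegral_congr_fun measurableSet_Ioc fun r hr => ?_
    rw [lintegral_mul_const _ (hm3 r), lintegral_mul_exp_integral hh h0 hr.1.le]
  have hone : ∀ r, b ≤ r → ENNReal.ofReal (Real.exp (-(r - b)) * Real.exp (∫ x in b..r, h x)) =
      ENNReal.ofReal (Real.exp (-(r - b))) +
        ENNReal.ofReal (Real.exp (∫ x in b..r, h x) - 1) *
          ENNReal.ofReal (Real.exp (-(r - b))) := by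
    intro r hr
    rw [← ENNReal.ofReal_mul (h1 r hr), ← ENNReal.ofReal_add (Real.exp_pos _).le
      (mul_nonneg (h1 r hr) (Real.exp_pos _).le)]
    congr 1
    ring
  have hlast : ∫⁻ r in Ioc b t,
      ENNReal.ofReal (Real.exp (-(r - b)) * Real.exp (∫ x in b..r, h x)) * v r =
      (∫⁻ r in Ioc b t, ENNReal.ofReal (Real.exp (∫ x in b..r, h x) - 1) *
        (ENNReal.ofReal (Real.exp (-(r - b))) * v r)) +
      ∫⁻ r in Ioc b t, ENNReal.ofReal (Real.exp (-(r - b))) * v r := by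
    rw [← lintegral_add_right _ hm1]
    refine setLIntegral_congr_fun measurableSet_Ioc fun r hr => ?_
    rw [hone r hr.1.le, add_mul, mul_assoc, add_comm]
  simp only [mul_add]
  rw [lintegral_add_right _ hm1, hmain, ha b ⟨le_rfl, hbt⟩, hlast, hone t hbt, add_mul, mul_assoc]
  simp only [add_assoc]

/-! ### Changes of variables for Lebesgue integrals on half-lines -/

lemma lintegral_Ioi_shift (a d : ℝ) (f : ℝ → ℝ≥0∞) :
    ∫⁻ x in Ioi (a + d), f x = ∫⁻ x in Ioi a, f (x + d) := by
  rw [← lintegral_indicator measurableSet_Ioi, ← lintegral_indicator measurableSet_Ioi,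
    ← lintegral_add_right_eq_self _ d]
  refine lintegral_congr fun x => ?_
  simp [indicator]

/-- The substitution `m = x + y`: two independent children are described by their total mass and the
mass of the first. -/
lemma lintegral_Ioi_Ioi {F : ℝ → ℝ → ℝ≥0∞} (hF : Measurable (Function.uncurry F)) :
    ∫⁻ x in Ioi 0, ∫⁻ y in Ioi 0, F x y = ∫⁻ m in Ioi 0, ∫⁻ x in Ioo 0 m, F x (m - x) := by
  set D : Set (ℝ × ℝ) := {z | 0 < z.1 ∧ z.1 < z.2} with hD
  have hDm : MeasurableSet D :=
    (measurableSet_lt measurable_const measurable_fst).inter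
      (measurableSet_lt measurable_fst measurable_snd)
  set G : ℝ × ℝ → ℝ≥0∞ := D.indicator fun z => F z.1 (z.2 - z.1) with hG
  have hGm : Measurable G := Measurable.indicator
    (hF.comp (measurable_fst.prodMk (measurable_snd.sub measurable_fst))) hDm
  have h1 : ∫⁻ x in Ioi 0, ∫⁻ y in Ioi 0, F x y = ∫⁻ x, ∫⁻ m, G (x, m) := by
    rw [← lintegral_indicator measurableSet_Ioi]
    refine lintegral_congr fun x => ?_
    by_cases hx : 0 < x
    · rw [indicator_of_mem (show x ∈ Ioi 0 from hx), ← lintegral_indicator measurableSet_Ioi,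
        ← lintegral_sub_right_eq_self _ x]
      refine lintegral_congr fun m => ?_
      simp [hG, hD, indicator, hx]
    · rw [indicator_of_notMem (show x ∉ Ioi 0 from hx)]
      simp [hG, hD, hx]
  have h2 : ∫⁻ m in Ioi 0, ∫⁻ x in Ioo 0 m, F x (m - x) = ∫⁻ m, ∫⁻ x, G (x, m) := by
    rw [← lintegral_indicator measurableSet_Ioi]
    refine lintegral_congr fun m => ?_
    by_cases hm : 0 < m
    · rw [indicator_of_mem (show m ∈ Ioi 0 from hm), ← lintegral_indicator measurableSet_Ioo]
      rfl
    · rw [indicator_of_notMem (show m ∉ Ioi 0 from hm)]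
      have : ∀ x, G (x, m) = 0 := fun x =>
        indicator_of_notMem (fun h => hm (h.1.trans h.2)) _
      simp [this]
  rw [h1, h2]
  exact lintegral_lintegral_swap hGm.aemeasurable

lemma measurable_lintegral_Ioo {α : Type*} [MeasurableSpace α] {F : α → ℝ → ℝ≥0∞}
    (hF : Measurable (Function.uncurry F)) {f : α → ℝ} (hf : Measurable f) :
    Measurable fun a => ∫⁻ y in Ioo 0 (f a), F a y := by
  have hD : MeasurableSet {z : α × ℝ | 0 < z.2 ∧ z.2 < f z.1} :=
    (measurableSet_lt measurable_const measurable_snd).inter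
      (measurableSet_lt measurable_snd (hf.comp measurable_fst))
  have h := Measurable.lintegral_prod_right' (ν := (volume : Measure ℝ)) (hF.indicator hD)
  convert h using 2 with a
  rw [← lintegral_indicator measurableSet_Ioo]
  rfl

/-! ### The law of the root mass together with the branching path -/

/-- The mass of a particle at its birth together with the path that it generates. -/
abbrev State (t : ℝ) := ℝ × Path t

/-- A particle without mass. -/
def emptyState (t : ℝ) : State t := (0, emptyPath t)

open Classical in
/-- The state at time `b` of a particle that splits at time `d` into two particles with states
`y₀` and `y₁`. -/
def joinState {t : ℝ} (b d : ℝ) (y₀ y₁ : State t) : State t :=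
  if y₀.1 + y₁.1 - (d - b) ≤ 0 then emptyState t else
    (y₀.1 + y₁.1 - (d - b), if 0 < y₀.1 then
      (if 0 < y₁.1 then splitPath (y₀.1 + y₁.1 - d) d y₀.2 y₁.2 else y₀.2) else y₁.2)

open Classical in
/-- The state at time `b` of a particle that has label `ξ` at time `t`. -/
def leafState (t b ξ : ℝ) : State t :=
  if ξ - (t - b) ≤ 0 then emptyState t else (ξ - (t - b), linePath t (ξ - t))

open Classical in
/-- The state at time `b` of a particle of mass `x` that follows the branching dynamics. -/
def startState (t : ℝ) (ρ : ℝ → ℝ) (b x : ℝ) (Z : Word → ℝ × I) : State t :=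
  if x ≤ 0 then emptyState t else (x, branchPath t ρ b x Z)

/-- The law of the state at time `b` of a particle whose mass has the law given by the solution of
the differential system and that follows the branching dynamics. -/
def flowLaw (p lam : ℝ → ℝ) (t b : ℝ) : Measure (State t) :=
  ((initialLaw (p (t - b)) (lam (t - b))).prod noise).map fun z =>
    startState t (rateOf p lam) b z.1 z.2

/-- The density on `(0, ∞)` of the law of the mass. -/
def massDensity (p lam : ℝ → ℝ) (s x : ℝ) : ℝ≥0∞ :=
  ENNReal.ofReal (rateOf p lam s * Real.exp (-(lam s * x)))

lemma lintegral_initialLaw {p l : ℝ} (hp : p < 1) {f : ℝ → ℝ≥0∞} (hf : Measurable f) :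
    ∫⁻ x, f x ∂(initialLaw p l) = ENNReal.ofReal p * f 0 +
      ∫⁻ x in Ioi (0 : ℝ), ENNReal.ofReal ((1 - p) * l * Real.exp (-(l * x))) * f x := by
  rw [initialLaw, lintegral_add_measure, lintegral_smul_measure, lintegral_smul_measure,
    lintegral_dirac' _ hf, lintegral_expMeasure l hf, smul_eq_mul, smul_eq_mul,
    ← lintegral_const_mul' _ _ ENNReal.ofReal_ne_top]
  congr 1
  refine lintegral_congr fun x => ?_
  rw [← mul_assoc, ← ENNReal.ofReal_mul (sub_pos.2 hp).le, mul_assoc (1 - p)]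

lemma isProbabilityMeasure_initialLaw {p l : ℝ} (hp : p ∈ Ico (0 : ℝ) 1) (hl : 0 < l) :
    IsProbabilityMeasure (initialLaw p l) := by
  have := isProbabilityMeasure_expMeasure hl
  constructor
  rw [initialLaw, Measure.add_apply, Measure.smul_apply, Measure.smul_apply, measure_univ,
    measure_univ, smul_eq_mul, smul_eq_mul, mul_one, mul_one,
    ← ENNReal.ofReal_add hp.1 (sub_pos.2 hp.2).le, add_sub_cancel, ENNReal.ofReal_one]

section FlowLaw

variable {t : ℝ} {ρ p lam : ℝ → ℝ} {α : Type*} [MeasurableSpace α]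

lemma measurable_startState (hρ : Continuous ρ) (hpos : ∀ s, 0 < ρ s) (b : ℝ) :
    Measurable fun z : ℝ × (Word → ℝ × I) => startState t ρ b z.1 z.2 :=
  Measurable.ite (measurableSet_le measurable_fst measurable_const) measurable_const
    (measurable_fst.prodMk
      (measurable_branchPath hρ hpos measurable_const measurable_fst measurable_snd))

lemma measurable_joinState {b d : α → ℝ} {y₀ y₁ : α → State t} (hb : Measurable b)
    (hd : Measurable d) (h₀ : Measurable y₀) (h₁ : Measurable y₁) :
    Measurable fun a => joinState (b a) (d a) (y₀ a) (y₁ a) := by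
  have hx : Measurable fun a => (y₀ a).1 + (y₁ a).1 - (d a - b a) := by fun_prop
  refine Measurable.ite (measurableSet_le hx measurable_const) measurable_const (hx.prodMk ?_)
  refine Measurable.ite (measurableSet_lt measurable_const (by fun_prop)) ?_ (by fun_prop)
  refine Measurable.ite (measurableSet_lt measurable_const (by fun_prop)) ?_ (by fun_prop)
  exact measurable_splitPath (by fun_prop) hd (by fun_prop) (by fun_prop)

lemma measurable_leafState {b ξ : α → ℝ} (hb : Measurable b) (hξ : Measurable ξ) :
    Measurable fun a => leafState t (b a) (ξ a) := by
  have hx : Measurable fun a => ξ a - (t - b a) := by fun_prop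
  exact Measurable.ite (measurableSet_le hx measurable_const) measurable_const
    (hx.prodMk (measurable_linePath.comp (hξ.sub_const _)))

lemma IsFlow.isProbabilityMeasure_flowLaw (hf : IsFlow p lam) (b : ℝ) :
    IsProbabilityMeasure (flowLaw p lam t b) := by
  have := isProbabilityMeasure_initialLaw ⟨hf.p_nonneg (t - b), hf.p_lt_one _⟩ (hf.lam_pos (t - b))
  exact Measure.isProbabilityMeasure_map
    (measurable_startState hf.continuous_rateOf hf.rateOf_pos b).aemeasurable

lemma IsFlow.lintegral_flowLaw (hf : IsFlow p lam) (b : ℝ) {φ : State t → ℝ≥0∞}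
    (hφ : Measurable φ) :
    ∫⁻ y, φ y ∂(flowLaw p lam t b) = ENNReal.ofReal (p (t - b)) * φ (emptyState t) +
      ∫⁻ x in Ioi (0 : ℝ), massDensity p lam (t - b) x *
        meanBranch t (rateOf p lam) (fun π => φ (x, π)) b x := by
  have := isProbabilityMeasure_initialLaw ⟨hf.p_nonneg (t - b), hf.p_lt_one _⟩ (hf.lam_pos (t - b))
  have hs := measurable_startState (t := t) hf.continuous_rateOf hf.rateOf_pos b
  have hφs : Measurable fun z : ℝ × (Word → ℝ × I) =>
      φ (startState t (rateOf p lam) b z.1 z.2) := hφ.comp hs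
  rw [flowLaw, lintegral_map hφ hs, lintegral_prod _ hφs.aemeasurable,
    lintegral_initialLaw (hf.p_lt_one _) hφs.lintegral_prod_right']
  congr 1
  · simp [startState]
  · refine setLIntegral_congr_fun measurableSet_Ioi fun x hx => ?_
    simp only [startState, if_neg (not_le.2 (show 0 < x from hx))]
    rfl

lemma IsFlow.measurable_massDensity (hf : IsFlow p lam) {s x : α → ℝ} (hs : Measurable s)
    (hx : Measurable x) : Measurable fun a => massDensity p lam (s a) (x a) := by
  have h1 := hf.continuous_rateOf.measurable
  have h2 := hf.continuous_lam.measurable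
  unfold massDensity
  fun_prop

/-- The contribution of the splittings at time `r` into two children with positive masses. -/
def splitDensity (p lam : ℝ → ℝ) (ψ : Path t → ℝ≥0∞) (c r : ℝ) : ℝ≥0∞ :=
  ∫⁻ y in Ioo 0 (c + r), massDensity p lam (t - r) y * massDensity p lam (t - r) (c + r - y) *
    meanSplit t (rateOf p lam) ψ c r y (c + r - y)

lemma IsFlow.measurable_splitDensity (hf : IsFlow p lam) {ψ : α → Path t → ℝ≥0∞}
    (hψ : Measurable (Function.uncurry ψ)) {c r : α → ℝ} (hc : Measurable c) (hr : Measurable r) :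
    Measurable fun a => splitDensity p lam (ψ a) (c a) (r a) := by
  refine measurable_lintegral_Ioo (F := fun a y => massDensity p lam (t - r a) y *
    massDensity p lam (t - r a) (c a + r a - y) *
    meanSplit t (rateOf p lam) (ψ a) (c a) (r a) y (c a + r a - y)) ?_ (hc.add hr)
  refine ((hf.measurable_massDensity (by fun_prop) (by fun_prop)).mul
    (hf.measurable_massDensity (by fun_prop) (by fun_prop))).mul ?_
  exact measurable_meanSplit (ψ := fun z : α × ℝ => ψ z.1) hf.continuous_rateOf hf.rateOf_pos
    (hψ.comp (measurable_fst.fst.prodMk measurable_snd)) (by fun_prop) (by fun_prop)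
    (by fun_prop) (by fun_prop)

/-- Integral equation satisfied by the law of the branching process with a random initial mass,
obtained by decomposing at the first splitting of the underlying Yule tree. -/
lemma IsFlow.massDensity_mul_meanBranch (hf : IsFlow p lam) {ψ : Path t → ℝ≥0∞}
    (hψ : Measurable ψ) {b x : ℝ} (hb : b ≤ t) (hx : 0 < x) :
    massDensity p lam (t - b) x * meanBranch t (rateOf p lam) ψ b x =
      ENNReal.ofReal (Real.exp (-(t - b))) *
        (massDensity p lam 0 (x + (t - b)) * ψ (linePath t (x - b))) +
      ∫⁻ r in Ioc b t, ENNReal.ofReal (Real.exp (-(r - b))) *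
        (ENNReal.ofReal (2 * p (t - r)) * (massDensity p lam (t - r) (x + (r - b)) *
          meanBranch t (rateOf p lam) ψ r (x + (r - b))) + splitDensity p lam ψ (x - b) r) := by
  have hρ := hf.continuous_rateOf
  have hp := hf.continuous_p
  set c := x - b with hc
  have hcr : ∀ r, x + (r - b) = c + r := fun r => by rw [hc]; ring
  -- Before its first visible splitting a particle stays on the line of intercept `c`, so the
  -- unknown is a function of time alone. Here `h` is the rate of invisible splittings and `v` the
  -- contribution of the visible ones.
  have key := volterra_of_resolvent (h := fun r => 2 * p (t - r)) (by fun_prop)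
    (fun r => mul_nonneg zero_le_two (hf.p_nonneg _)) hb
    (a := fun r => massDensity p lam (t - r) (c + r) * meanBranch t (rateOf p lam) ψ r (c + r))
    (v := fun r => splitDensity p lam ψ c r)
    (hf.measurable_splitDensity (ψ := fun _ => ψ) (hψ.comp measurable_snd) measurable_const
      measurable_id)
    (massDensity p lam 0 (c + t) * ψ (linePath t c)) ?_
  · simp only [hcr]
    simpa [hc] using key
  intro q hq
  have hcq : 0 < c + q := by rw [hc]; linarith [hq.1]
  have hdens : ∀ r, q ≤ r → r ≤ t → massDensity p lam (t - q) (c + q) *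
      ENNReal.ofReal (Real.exp (-cumRate t (rateOf p lam) q (c + q) r)) =
      ENNReal.ofReal (Real.exp (-(r - q)) * Real.exp (∫ x in q..r, 2 * p (t - x))) *
        massDensity p lam (t - r) (c + r) := by
    intro r hqr hr
    rw [massDensity, massDensity, ← ENNReal.ofReal_mul
      (mul_nonneg (hf.rateOf_pos _).le (Real.exp_pos _).le), ← ENNReal.ofReal_mul
      (mul_nonneg (Real.exp_pos _).le (Real.exp_pos _).le), hf.density_mul_exp_cumRate hqr hr]
  rw [meanBranch_firstSplit hρ hf.rateOf_pos hψ hq.2 hcq, mul_add, ← mul_assoc,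
    hdens t hq.2 le_rfl, mul_assoc, sub_self, add_sub_cancel_right,
    ← lintegral_const_mul' _ _ (by exact ENNReal.ofReal_ne_top)]
  congr 1
  refine setLIntegral_congr_fun measurableSet_Ioc fun r hr => ?_
  rw [add_assoc c q, add_sub_cancel, ENNReal.ofReal_mul (hf.rateOf_pos _).le,
    mul_comm (ENNReal.ofReal (rateOf p lam (t - r))), mul_assoc, ← mul_assoc,
    hdens r hr.1.le hr.2, mul_assoc, splitDensity, ← lintegral_const_mul' _ _ (by finiteness),
    ← lintegral_const_mul' _ _ (by exact ENNReal.ofReal_ne_top)]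
  congr 1
  refine lintegral_congr fun y => ?_
  rw [← mul_assoc]
  congr 1
  rw [massDensity, massDensity, massDensity, ← ENNReal.ofReal_mul
    (mul_nonneg (hf.rateOf_pos _).le (Real.exp_pos _).le), ← ENNReal.ofReal_mul
    (mul_nonneg (hf.rateOf_pos _).le (Real.exp_pos _).le)]
  congr 1
  -- Lack of memory of the exponential density: the product for the two children depends only on
  -- their total mass, so the share is uniform.
  have : Real.exp (-(lam (t - r) * (c + r))) =
      Real.exp (-(lam (t - r) * y)) * Real.exp (-(lam (t - r) * (c + r - y))) := by
    rw [← Real.exp_add]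
    congr 1
    ring
  rw [this]
  ring

end FlowLaw

/-! ### Invariance of the family of laws `flowLaw` under the recursion of the Yule tree -/

/-- Used when going down a branch of length `a`: masses at most `a` are lost, and the others are
parametrized by what remains. -/
lemma lintegral_Ioi_shift_of_eq_zero {a : ℝ} (ha : 0 ≤ a) {f : ℝ → ℝ≥0∞}
    (hf : ∀ x, x ≤ a → f x = 0) : ∫⁻ x in Ioi 0, f x = ∫⁻ x in Ioi 0, f (x + a) := by
  rw [← lintegral_Ioi_shift, zero_add, ← lintegral_indicator measurableSet_Ioi,
    ← lintegral_indicator measurableSet_Ioi]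
  refine lintegral_congr fun x => ?_
  by_cases hx : a < x
  · rw [indicator_of_mem (show x ∈ Ioi 0 from ha.trans_lt hx), indicator_of_mem
      (show x ∈ Ioi a from hx)]
  · rw [indicator_of_notMem (show x ∉ Ioi a from hx), indicator_apply_eq_zero]
    exact fun _ => hf x (not_lt.1 hx)

lemma ae_expMeasure_pos : ∀ᵐ a ∂(expMeasure 1), 0 < a := by
  have h : expMeasure 1 {a | ¬ 0 < a} = 0 := by
    have hm : MeasurableSet {a : ℝ | ¬ 0 < a} := (measurableSet_Ioi (a := (0 : ℝ))).compl
    rw [← lintegral_indicator_one hm, lintegral_expMeasure 1 (measurable_one.indicator hm)]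
    rw [setLIntegral_congr_fun (g := fun _ => 0) measurableSet_Ioi fun x hx => ?_]
    · simp
    · simp [show 0 < x from hx]
  exact h

section YuleStep

variable {t : ℝ} {p lam : ℝ → ℝ}

/-- Paths are extended linearly before birth precisely for this: in an invisible splitting, the path
of the child that carries mass already is that of its parent. -/
lemma joinState_empty_left (b d x : ℝ) (π : Path t) :
    joinState b d (emptyState t) (x, π) =
      if x ≤ d - b then emptyState t else (x - (d - b), π) := by
  simp [joinState, emptyState]

lemma joinState_empty_right (b d x : ℝ) (π : Path t) (hx : 0 < x) :
    joinState b d (x, π) (emptyState t) =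
      if x ≤ d - b then emptyState t else (x - (d - b), π) := by
  simp [joinState, emptyState, hx]

lemma joinState_of_pos (b d : ℝ) {x₀ x₁ : ℝ} (π₀ π₁ : Path t) (h₀ : 0 < x₀) (h₁ : 0 < x₁) :
    joinState b d (x₀, π₀) (x₁, π₁) = if x₀ + x₁ ≤ d - b then emptyState t else
      (x₀ + x₁ - (d - b), splitPath (x₀ + x₁ - d) d π₀ π₁) := by
  simp [joinState, h₀, h₁]

/-- Expand according to which children have mass. Two empty children give nothing, as `φ` kills the
empty state; the two cases with one empty child (`single`) give the factor `2 p`; two positive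
masses (`pair`) give `splitDensity` once rewritten in terms of the total mass. -/
lemma IsFlow.lintegral_joinState (hf : IsFlow p lam) {b d : ℝ} (hbd : b ≤ d)
    {φ : State t → ℝ≥0∞} (hφ : Measurable φ) (h0 : φ (emptyState t) = 0) :
    ∫⁻ y₀, ∫⁻ y₁, φ (joinState b d y₀ y₁) ∂(flowLaw p lam t d) ∂(flowLaw p lam t d) =
      ∫⁻ x in Ioi 0, (ENNReal.ofReal (2 * p (t - d)) * (massDensity p lam (t - d) (x + (d - b)) *
        meanBranch t (rateOf p lam) (fun π => φ (x, π)) d (x + (d - b))) +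
        splitDensity p lam (fun π => φ (x, π)) (x - b) d) := by
  have := hf.isProbabilityMeasure_flowLaw (t := t) d
  have hρ := hf.continuous_rateOf
  have hpos := hf.rateOf_pos
  have hbp : ∀ {β : Type} [MeasurableSpace β] {m : β → ℝ} {Z : β → Word → ℝ × I}, Measurable m →
      Measurable Z → Measurable fun a => branchPath t (rateOf p lam) d (m a) (Z a) :=
    fun hm hZ => measurable_branchPath hρ hpos measurable_const hm hZ
  have hdb : 0 ≤ d - b := sub_nonneg.2 hbd
  have hj : Measurable fun z : State t × State t => φ (joinState b d z.1 z.2) :=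
    hφ.comp (measurable_joinState measurable_const measurable_const measurable_fst measurable_snd)
  have hjr : ∀ y₀, Measurable fun y₁ => φ (joinState b d y₀ y₁) := fun y₀ =>
    hj.comp measurable_prodMk_left
  set single : ℝ → ℝ≥0∞ := fun x => massDensity p lam (t - d) x *
    meanBranch t (rateOf p lam) (fun π => if x ≤ d - b then 0 else φ (x - (d - b), π)) d x
    with hsingle
  set pair : ℝ → ℝ → ℝ≥0∞ := fun x₀ x₁ => massDensity p lam (t - d) x₀ *
    (massDensity p lam (t - d) x₁ * ∫⁻ Z₀, ∫⁻ Z₁, φ (joinState b d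
      (x₀, branchPath t (rateOf p lam) d x₀ Z₀) (x₁, branchPath t (rateOf p lam) d x₁ Z₁))
      ∂noise ∂noise) with hpair
  have hpairZ : Measurable fun z : ((ℝ × ℝ) × (Word → ℝ × I)) × (Word → ℝ × I) =>
      φ (joinState b d (z.1.1.1, branchPath t (rateOf p lam) d z.1.1.1 z.1.2)
        (z.1.1.2, branchPath t (rateOf p lam) d z.1.1.2 z.2)) := by
    refine hφ.comp (measurable_joinState measurable_const measurable_const
      (Measurable.prodMk (by fun_prop) (hbp ?_ ?_)) (Measurable.prodMk (by fun_prop) (hbp ?_ ?_)))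
    all_goals fun_prop
  have hpairm : Measurable (Function.uncurry pair) := by
    refine (hf.measurable_massDensity measurable_const measurable_fst).mul
      ((hf.measurable_massDensity measurable_const measurable_snd).mul ?_)
    exact Measurable.lintegral_prod_right' (f := fun z : (ℝ × ℝ) × (Word → ℝ × I) =>
      ∫⁻ Z₁, φ (joinState b d (z.1.1, branchPath t (rateOf p lam) d z.1.1 z.2)
        (z.1.2, branchPath t (rateOf p lam) d z.1.2 Z₁)) ∂noise) hpairZ.lintegral_prod_right'
  have hsinglem : Measurable single := by
    refine (hf.measurable_massDensity measurable_const measurable_id).mul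
      (measurable_meanBranch (ψ := fun x π => if x ≤ d - b then 0 else φ (x - (d - b), π))
        hρ hpos ?_ measurable_const measurable_id)
    refine Measurable.ite (measurableSet_le measurable_fst measurable_const) measurable_const
      (hφ.comp ?_)
    fun_prop
  have hleft : ∫⁻ y₁, φ (joinState b d (emptyState t) y₁) ∂(flowLaw p lam t d) =
      ∫⁻ x in Ioi 0, single x := by
    rw [hf.lintegral_flowLaw d (hjr _)]
    have : joinState b d (emptyState t) (emptyState t) = emptyState t := by
      simp [joinState, emptyState, hbd]
    rw [this, h0, mul_zero, zero_add]
    refine setLIntegral_congr_fun measurableSet_Ioi fun x hx => ?_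
    simp only [hsingle, joinState_empty_left b d x _, apply_ite φ, h0]
  have hright : ∀ x, 0 < x → massDensity p lam (t - d) x * meanBranch t (rateOf p lam)
      (fun π => ∫⁻ y₁, φ (joinState b d (x, π) y₁) ∂(flowLaw p lam t d)) d x =
      ENNReal.ofReal (p (t - d)) * single x + ∫⁻ x₁ in Ioi 0, pair x x₁ := by
    intro x hx
    have h1 : ∀ π, ∫⁻ y₁, φ (joinState b d (x, π) y₁) ∂(flowLaw p lam t d) =
        ENNReal.ofReal (p (t - d)) * (if x ≤ d - b then 0 else φ (x - (d - b), π)) +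
        ∫⁻ x₁ in Ioi 0, massDensity p lam (t - d) x₁ *
          ∫⁻ Z₁, φ (joinState b d (x, π) (x₁, branchPath t (rateOf p lam) d x₁ Z₁)) ∂noise := by
      intro π
      rw [hf.lintegral_flowLaw d (hjr _), joinState_empty_right b d x π hx, apply_ite φ, h0]
      rfl
    have hm1 : Measurable fun Z => (if x ≤ d - b then 0 else
        φ (x - (d - b), branchPath t (rateOf p lam) d x Z)) := by
      split_ifs
      · exact measurable_const
      · exact hφ.comp (measurable_const.prodMk (hbp measurable_const measurable_id))
    simp only [meanBranch, h1]
    rw [lintegral_add_left (hm1.const_mul _), mul_add, lintegral_const_mul _ hm1]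
    congr 1
    · simp only [hsingle, meanBranch]
      ring
    · have hm2 : Measurable fun z : (Word → ℝ × I) × ℝ => massDensity p lam (t - d) z.2 *
          ∫⁻ Z₁, φ (joinState b d (x, branchPath t (rateOf p lam) d x z.1)
            (z.2, branchPath t (rateOf p lam) d z.2 Z₁)) ∂noise := by
        refine (hf.measurable_massDensity measurable_const measurable_snd).mul ?_
        refine Measurable.lintegral_prod_right' (f := fun z : ((Word → ℝ × I) × ℝ) ×
          (Word → ℝ × I) => φ (joinState b d (x, branchPath t (rateOf p lam) d x z.1.1)
            (z.1.2, branchPath t (rateOf p lam) d z.1.2 z.2))) ?_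
        exact hpairZ.comp (by fun_prop : Measurable fun z : ((Word → ℝ × I) × ℝ) ×
          (Word → ℝ × I) => (((x, z.1.2), z.1.1), z.2))
      rw [lintegral_lintegral_swap (f := fun Z x₁ => massDensity p lam (t - d) x₁ *
        ∫⁻ Z₁, φ (joinState b d (x, branchPath t (rateOf p lam) d x Z)
          (x₁, branchPath t (rateOf p lam) d x₁ Z₁)) ∂noise) hm2.aemeasurable,
        ← lintegral_const_mul' _ _ (by exact ENNReal.ofReal_ne_top)]
      refine lintegral_congr fun x₁ => ?_
      simp only [hpair]
      rw [lintegral_const_mul' _ _ (by exact ENNReal.ofReal_ne_top)]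
  have hshift1 : ∫⁻ x in Ioi 0, single x = ∫⁻ x in Ioi 0,
      massDensity p lam (t - d) (x + (d - b)) *
        meanBranch t (rateOf p lam) (fun π => φ (x, π)) d (x + (d - b)) := by
    rw [lintegral_Ioi_shift_of_eq_zero hdb fun x hx => by simp [hsingle, hx, meanBranch]]
    refine setLIntegral_congr_fun measurableSet_Ioi fun x hx => ?_
    have : ¬ x + (d - b) ≤ d - b := not_le.2 (lt_add_of_pos_left _ hx)
    simp only [hsingle, if_neg this, add_sub_cancel_right]
  have hshift2 : ∫⁻ x₀ in Ioi 0, ∫⁻ x₁ in Ioi 0, pair x₀ x₁ = ∫⁻ x in Ioi 0,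
      splitDensity p lam (fun π => φ (x, π)) (x - b) d := by
    rw [lintegral_Ioi_Ioi hpairm, lintegral_Ioi_shift_of_eq_zero hdb fun m hm => ?_]
    · refine setLIntegral_congr_fun measurableSet_Ioi fun x hx => ?_
      have hxd : x - b + d = x + (d - b) := by ring
      rw [splitDensity, hxd]
      refine setLIntegral_congr_fun measurableSet_Ioo fun y hy => ?_
      have hx' : ¬ x + (d - b) ≤ d - b := not_le.2 (lt_add_of_pos_left _ hx)
      have hxb : x + (d - b) - d = x - b := by ring
      simp only [hpair, joinState_of_pos b d _ _ hy.1 (sub_pos.2 hy.2), add_sub_cancel, if_neg hx',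
        add_sub_cancel_right, hxb, meanSplit, mul_assoc]
    · rw [setLIntegral_congr_fun (g := fun _ => 0) measurableSet_Ioo fun y hy => ?_]
      · simp
      · simp only [hpair, joinState_of_pos b d _ _ hy.1 (sub_pos.2 hy.2), add_sub_cancel, if_pos hm,
          h0, lintegral_zero, mul_zero]
  have hp2 : ENNReal.ofReal (2 * p (t - d)) =
      ENNReal.ofReal (p (t - d)) + ENNReal.ofReal (p (t - d)) := by
    rw [← ENNReal.ofReal_add (hf.p_nonneg _) (hf.p_nonneg _), two_mul]
  have hm3 : Measurable fun x => massDensity p lam (t - d) (x + (d - b)) *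
      meanBranch t (rateOf p lam) (fun π => φ (x, π)) d (x + (d - b)) :=
    (hf.measurable_massDensity measurable_const (by fun_prop)).mul
      (measurable_meanBranch (ψ := fun x π => φ (x, π)) hρ hpos hφ measurable_const (by fun_prop))
  rw [hf.lintegral_flowLaw d hj.lintegral_prod_right', hleft,
    setLIntegral_congr_fun measurableSet_Ioi hright,
    lintegral_add_left (hsinglem.const_mul _), lintegral_const_mul _ hsinglem, hshift1, hshift2,
    lintegral_add_left (hm3.const_mul _), lintegral_const_mul _ hm3, hp2, add_mul, add_assoc]

lemma IsFlow.lintegral_leafState (hf : IsFlow p lam) {b : ℝ} (hb : b ≤ t)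
    {φ : State t → ℝ≥0∞} (hφ : Measurable φ) (h0 : φ (emptyState t) = 0) :
    ∫⁻ ξ, φ (leafState t b ξ) ∂(initialLaw (p 0) (lam 0)) =
      ∫⁻ x in Ioi 0, massDensity p lam 0 (x + (t - b)) * φ (x, linePath t (x - b)) := by
  have hl : Measurable fun ξ => φ (leafState t b ξ) :=
    hφ.comp (measurable_leafState measurable_const measurable_id)
  rw [lintegral_initialLaw (hf.p_lt_one 0) hl]
  have h1 : leafState t b 0 = emptyState t := by simp [leafState, hb]
  rw [h1, h0, mul_zero, zero_add, lintegral_Ioi_shift_of_eq_zero (sub_nonneg.2 hb) fun x hx => ?_]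
  · refine setLIntegral_congr_fun measurableSet_Ioi fun x hx => ?_
    have hx' : ¬ x ≤ 0 := not_le.2 hx
    have hxb : x + (t - b) - t = x - b := by ring
    simp only [leafState, add_sub_cancel_right, if_neg hx', hxb]
    rfl
  · simp [leafState, hx, h0]

open Classical in
/-- Expectation of `φ` for the state at time `b` of a particle whose lifetime is exponential, when
the states of its children at their birth are independent with laws given by `M` and the labels at
time `t` have law `μ`. -/
def yuleStep (M : ℝ → Measure (State t)) (μ : Measure ℝ) (b : ℝ) (φ : State t → ℝ≥0∞) : ℝ≥0∞ :=
  ∫⁻ a, (if b + a ≤ t then ∫⁻ y₀, ∫⁻ y₁, φ (joinState b (b + a) y₀ y₁) ∂(M (b + a)) ∂(M (b + a))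
    else ∫⁻ ξ, φ (leafState t b ξ) ∂μ) ∂(expMeasure 1)

/-- Exchange the integrals over the first Yule splitting time and over the mass `x` at time `b`. For
fixed `x`, the leaf term and the two kinds of splittings form the right-hand side of
`IsFlow.massDensity_mul_meanBranch`. -/
lemma IsFlow.yuleStep_of_empty (hf : IsFlow p lam) {b : ℝ} (hb : b ≤ t)
    {φ : State t → ℝ≥0∞} (hφ : Measurable φ) (h0 : φ (emptyState t) = 0) :
    yuleStep (flowLaw p lam t) (initialLaw (p 0) (lam 0)) b φ =
      ∫⁻ y, φ y ∂(flowLaw p lam t b) := by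
  classical
  have hρ := hf.continuous_rateOf
  have hpos := hf.rateOf_pos
  have hp := hf.continuous_p
  set T : ℝ → ℝ → ℝ≥0∞ := fun d x =>
    ENNReal.ofReal (2 * p (t - d)) * (massDensity p lam (t - d) (x + (d - b)) *
      meanBranch t (rateOf p lam) (fun π => φ (x, π)) d (x + (d - b))) +
      splitDensity p lam (fun π => φ (x, π)) (x - b) d with hT
  set L : ℝ → ℝ≥0∞ := fun x =>
    massDensity p lam 0 (x + (t - b)) * φ (x, linePath t (x - b)) with hL
  have hφ' : Measurable (Function.uncurry fun (z : ℝ × ℝ) (π : Path t) => φ (z.2, π)) :=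
    hφ.comp (by fun_prop)
  have hTm : Measurable (Function.uncurry T) := by
    refine Measurable.add (Measurable.mul ?_ (Measurable.mul ?_ ?_)) ?_
    · exact (hp.measurable.comp (measurable_const.sub measurable_fst)).const_mul _ |>.ennreal_ofReal
    · exact hf.measurable_massDensity (by fun_prop) (by fun_prop)
    · exact measurable_meanBranch (ψ := fun (z : ℝ × ℝ) π => φ (z.2, π)) hρ hpos hφ'
        measurable_fst (by fun_prop)
    · exact hf.measurable_splitDensity (ψ := fun (z : ℝ × ℝ) π => φ (z.2, π)) hφ'
        (by fun_prop) measurable_fst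
  have hLm : Measurable L :=
    (hf.measurable_massDensity measurable_const (by fun_prop)).mul
      (hφ.comp (measurable_id.prodMk (measurable_linePath.comp (measurable_id.sub_const b))))
  set h : ℝ → ℝ≥0∞ := fun d => if d ≤ t then ∫⁻ x in Ioi 0, T d x else ∫⁻ x in Ioi 0, L x with hh
  have hhm : Measurable h :=
    Measurable.ite measurableSet_Iic hTm.lintegral_prod_right' measurable_const
  have h1 : yuleStep (flowLaw p lam t) (initialLaw (p 0) (lam 0)) b φ =
      ∫⁻ a, h (a + b) ∂(expMeasure 1) := by
    refine lintegral_congr_ae ?_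
    filter_upwards [ae_expMeasure_pos] with a ha
    rw [add_comm a b]
    by_cases hat : b + a ≤ t
    · simp only [hh, if_pos hat, hT]
      rw [hf.lintegral_joinState (by linarith) hφ h0]
    · simp only [hh, if_neg hat, hL]
      rw [hf.lintegral_leafState hb hφ h0]
  have h2 : ∀ c : ℝ, ∫⁻ d in Ioi c, ENNReal.ofReal (Real.exp (-(d - b))) =
      ENNReal.ofReal (Real.exp (-(c - b))) := by
    intro c
    have := lintegral_Ioi_shift (c - b) b fun d => ENNReal.ofReal (Real.exp (-(d - b)))
    simpa only [sub_add_cancel, add_sub_cancel_right, lintegral_exp_neg_Ioi] using this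
  have h3 : ∫⁻ a, h (a + b) ∂(expMeasure 1) =
      ∫⁻ d in Ioi b, ENNReal.ofReal (Real.exp (-(d - b))) * h d := by
    rw [lintegral_expMeasure 1 (h := fun a => h (a + b)) (hhm.comp (measurable_id.add_const b))]
    have := lintegral_Ioi_shift 0 b fun d => ENNReal.ofReal (Real.exp (-(d - b))) * h d
    simpa only [zero_add, add_sub_cancel_right, one_mul] using this.symm
  have h4 : ∫⁻ d in Ioc b t, ENNReal.ofReal (Real.exp (-(d - b))) * h d =
      ∫⁻ x in Ioi 0, ∫⁻ d in Ioc b t, ENNReal.ofReal (Real.exp (-(d - b))) * T d x := by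
    rw [← lintegral_lintegral_swap]
    · refine setLIntegral_congr_fun measurableSet_Ioc fun d hd => ?_
      simp only [hh, if_pos hd.2]
      rw [lintegral_const_mul' _ _ ENNReal.ofReal_ne_top]
    · refine Measurable.aemeasurable (Measurable.mul ?_ hTm)
      fun_prop
  have h5 : ∫⁻ d in Ioi t, ENNReal.ofReal (Real.exp (-(d - b))) * h d =
      ∫⁻ x in Ioi 0, ENNReal.ofReal (Real.exp (-(t - b))) * L x := by
    rw [setLIntegral_congr_fun (g := fun d => ENNReal.ofReal (Real.exp (-(d - b))) *
      ∫⁻ x in Ioi 0, L x) measurableSet_Ioi fun d hd => ?_]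
    · rw [lintegral_mul_const _ (by fun_prop), h2, lintegral_const_mul _ hLm]
    · simp only [hh, if_neg (not_le.2 (show t < d from hd))]
  rw [h1, h3, ← Ioc_union_Ioi_eq_Ioi hb, lintegral_union measurableSet_Ioi
    (Ioc_disjoint_Ioi le_rfl), h4, h5, add_comm, ← lintegral_add_left (hLm.const_mul _),
    hf.lintegral_flowLaw b hφ, h0, mul_zero, zero_add]
  refine setLIntegral_congr_fun measurableSet_Ioi fun x hx => ?_
  exact (hf.massDensity_mul_meanBranch (hφ.comp measurable_prodMk_left) hb hx).symm

lemma yuleStep_mono {M N : ℝ → Measure (State t)} {μ : Measure ℝ} {b : ℝ}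
    (h : ∀ d, b ≤ d → d ≤ t → M d ≤ N d) (φ : State t → ℝ≥0∞) :
    yuleStep M μ b φ ≤ yuleStep N μ b φ := by
  refine lintegral_mono_ae ?_
  filter_upwards [ae_expMeasure_pos] with a ha
  split_ifs with hat
  · have := h (b + a) (by linarith) hat
    exact lintegral_mono' this fun y₀ => lintegral_mono' this fun y₁ => le_rfl
  · exact le_rfl

/-- When `A` contains the empty state, pass to the complement: the two values of `yuleStep` add up
to at most one, and the value at `Aᶜ` is known. As only an upper bound is sought, the
superadditivity `le_lintegral_add` suffices and requires no measurability. -/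
lemma IsFlow.yuleStep_indicator_le (hf : IsFlow p lam) {b : ℝ} (hb : b ≤ t) {A : Set (State t)}
    (hA : MeasurableSet A) :
    yuleStep (flowLaw p lam t) (initialLaw (p 0) (lam 0)) b (A.indicator 1) ≤
      flowLaw p lam t b A := by
  have := hf.isProbabilityMeasure_flowLaw (t := t)
  have := isProbabilityMeasure_initialLaw ⟨hf.p_nonneg 0, hf.p_lt_one _⟩ (hf.lam_pos 0)
  by_cases h : emptyState t ∈ A
  · have hc := hf.yuleStep_of_empty hb (φ := Aᶜ.indicator 1) (measurable_one.indicator hA.compl)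
      (by simp [h])
    rw [lintegral_indicator_one hA.compl] at hc
    have hone : ∀ y : State t, A.indicator (1 : State t → ℝ≥0∞) y + Aᶜ.indicator 1 y = 1 := by
      intro y
      by_cases hy : y ∈ A <;> simp [hy]
    have hsum : yuleStep (flowLaw p lam t) (initialLaw (p 0) (lam 0)) b (A.indicator 1) +
        yuleStep (flowLaw p lam t) (initialLaw (p 0) (lam 0)) b (Aᶜ.indicator 1) ≤ 1 := by
      refine (le_lintegral_add _ _).trans ?_
      refine (lintegral_mono (g := fun _ => 1) fun a => ?_).trans (by simp)
      simp only
      split_ifs with hat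
      · refine (le_lintegral_add _ _).trans ((lintegral_mono (g := fun _ => 1)
          fun y₀ => ?_).trans (by simp))
        refine (le_lintegral_add _ _).trans ((lintegral_mono (g := fun _ => 1)
          fun y₁ => ?_).trans (by simp))
        exact (hone _).le
      · refine (le_lintegral_add _ _).trans ((lintegral_mono (g := fun _ => 1)
          fun y₁ => ?_).trans (by simp))
        exact (hone _).le
    rw [hc, prob_compl_eq_one_sub hA] at hsum
    have h1 : flowLaw p lam t b A ≤ 1 := prob_le_one
    refine (ENNReal.le_sub_of_add_le_right (by finiteness) hsum).trans ?_
    rw [ENNReal.sub_sub_cancel ENNReal.one_ne_top h1]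
  · rw [hf.yuleStep_of_empty hb (measurable_one.indicator hA) (by simp [h]),
      lintegral_indicator_one hA]

end YuleStep

/-! ### The red tree by recursion from the root -/

/-- The state at time `b` of the red tree whose root is born at time `b` and whose lifetimes and
labels are given by `η`, when at most `n` generations are explored. -/
def redState (t : ℝ) : ℕ → (Word → ℝ × ℝ) → ℝ → State t
  | 0, _, _ => emptyState t
  | n + 1, η, b =>
    if b + (η []).1 ≤ t then
      joinState b (b + (η []).1) (redState t n (fun w => η (0 :: w)) (b + (η []).1))
        (redState t n (fun w => η (1 :: w)) (b + (η []).1))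
    else leafState t b (η []).2

/-- The tree with a root born at time `b` has less than `n` generations at time `t`. -/
def FewGenerations (t : ℝ) : ℕ → (Word → ℝ × ℝ) → ℝ → Prop
  | 0, _, _ => False
  | n + 1, η, b => t < b + (η []).1 ∨
    (FewGenerations t n (fun w => η (0 :: w)) (b + (η []).1) ∧
      FewGenerations t n (fun w => η (1 :: w)) (b + (η []).1))

lemma indicator_one_congr {α β : Type*} {S : Set α} {T : Set β} {x : α} {y : β}
    (h : x ∈ S ↔ y ∈ T) : S.indicator (1 : α → ℝ≥0∞) x = T.indicator 1 y := by
  by_cases hx : x ∈ S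
  · simp [hx, h.1 hx]
  · simp [hx, mt h.2 hx]

lemma fewGenerations_graft {t : ℝ} (n : ℕ) (a x : ℝ) (η₀ η₁ : Word → ℝ × ℝ) (b : ℝ) :
    FewGenerations t (n + 1) (graft (a, x) η₀ η₁) b ↔
      t < b + a ∨ (FewGenerations t n η₀ (b + a) ∧ FewGenerations t n η₁ (b + a)) := Iff.rfl

lemma redState_graft {t : ℝ} (n : ℕ) (a x : ℝ) (η₀ η₁ : Word → ℝ × ℝ) (b : ℝ) :
    redState t (n + 1) (graft (a, x) η₀ η₁) b = if b + a ≤ t then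
      joinState b (b + a) (redState t n η₀ (b + a)) (redState t n η₁ (b + a))
      else leafState t b x := rfl

section RedLaw

variable {t : ℝ} {α : Type*} [MeasurableSpace α]

lemma FewGenerations.succ {n : ℕ} {η : Word → ℝ × ℝ} {b : ℝ} (h : FewGenerations t n η b) :
    FewGenerations t (n + 1) η b := by
  induction n generalizing η b with
  | zero => exact h.elim
  | succ n ih => exact h.imp_right fun h => ⟨ih h.1, ih h.2⟩

lemma measurable_redState (n : ℕ) {η : α → Word → ℝ × ℝ} {b : α → ℝ} (hη : Measurable η)
    (hb : Measurable b) : Measurable fun a => redState t n (η a) (b a) := by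
  induction n generalizing η b with
  | zero => exact measurable_const
  | succ n ih =>
    have hd : Measurable fun a => b a + (η a []).1 := by fun_prop
    exact Measurable.ite (measurableSet_le hd measurable_const)
      (measurable_joinState hb hd (ih (by fun_prop) hd) (ih (by fun_prop) hd))
      (measurable_leafState hb (by fun_prop))

lemma measurableSet_fewGenerations (n : ℕ) {η : α → Word → ℝ × ℝ} {b : α → ℝ} (hη : Measurable η)
    (hb : Measurable b) : MeasurableSet {a | FewGenerations t n (η a) (b a)} := by
  induction n generalizing η b with
  | zero => exact MeasurableSet.const False
  | succ n ih =>
    have hd : Measurable fun a => b a + (η a []).1 := by fun_prop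
    exact (measurableSet_lt measurable_const hd).union
      ((ih (by fun_prop) hd).inter (ih (by fun_prop) hd))

/-- The law of independent pairs of a lifetime and a label, indexed by the words. -/
def treeNoise (μ : Measure ℝ) : Measure (Word → ℝ × ℝ) :=
  Measure.infinitePi fun _ : Word => (expMeasure 1).prod μ

instance (μ : Measure ℝ) [IsProbabilityMeasure μ] : IsProbabilityMeasure (treeNoise μ) := by
  unfold treeNoise
  infer_instance

/-- The law of `redState` restricted to the event that the tree is fully explored. -/
def redLaw (t : ℝ) (μ : Measure ℝ) (n : ℕ) (b : ℝ) : Measure (State t) :=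
  ((treeNoise μ).restrict {η | FewGenerations t n η b}).map fun η => redState t n η b

lemma redLaw_apply {μ : Measure ℝ} (n : ℕ) (b : ℝ) {A : Set (State t)} (hA : MeasurableSet A) :
    redLaw t μ n b A = treeNoise μ {η | FewGenerations t n η b ∧ redState t n η b ∈ A} := by
  have hm : Measurable fun η => redState t n η b :=
    measurable_redState n measurable_id measurable_const
  rw [redLaw, Measure.map_apply hm hA, Measure.restrict_apply (hm hA), inter_comm]
  rfl

variable {μ : Measure ℝ} [IsProbabilityMeasure μ]

lemma lintegral_lintegral_redLaw (n : ℕ) (b d : ℝ) {A : Set (State t)} (hA : MeasurableSet A) :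
    ∫⁻ y₀, ∫⁻ y₁, A.indicator 1 (joinState b d y₀ y₁) ∂(redLaw t μ n d) ∂(redLaw t μ n d) =
      ∫⁻ η₀, ∫⁻ η₁, {z : (Word → ℝ × ℝ) × (Word → ℝ × ℝ) | (FewGenerations t n z.1 d ∧
        FewGenerations t n z.2 d) ∧ joinState b d (redState t n z.1 d) (redState t n z.2 d) ∈ A
        }.indicator 1 (η₀, η₁) ∂(treeNoise μ) ∂(treeNoise μ) := by
  have hs : Measurable fun η => redState t n η d :=
    measurable_redState n measurable_id measurable_const
  have hF : MeasurableSet {η | FewGenerations t n η d} :=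
    measurableSet_fewGenerations n measurable_id measurable_const
  have hfin : SFinite (redLaw t μ n d) := by
    unfold redLaw
    infer_instance
  have hj : Measurable fun z : State t × State t =>
      A.indicator (1 : State t → ℝ≥0∞) (joinState b d z.1 z.2) :=
    (measurable_one.indicator hA).comp
      (measurable_joinState measurable_const measurable_const measurable_fst measurable_snd)
  have hjr : ∀ y₀, Measurable fun y₁ => A.indicator (1 : State t → ℝ≥0∞) (joinState b d y₀ y₁) :=
    fun y₀ => hj.comp measurable_prodMk_left
  rw [redLaw, lintegral_map hj.lintegral_prod_right' hs]
  change ∫⁻ η₀ in {η | FewGenerations t n η d}, ∫⁻ y₁, A.indicator (1 : State t → ℝ≥0∞)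
    (joinState b d (redState t n η₀ d) y₁) ∂_ ∂_ = _
  rw [← lintegral_indicator hF]
  refine lintegral_congr fun η₀ => ?_
  by_cases h₀ : FewGenerations t n η₀ d
  · rw [indicator_of_mem (show η₀ ∈ {η | FewGenerations t n η d} from h₀), lintegral_map (hjr _) hs]
    change ∫⁻ η₁ in {η | FewGenerations t n η d}, _ ∂_ = _
    rw [← lintegral_indicator hF]
    refine lintegral_congr fun η₁ => ?_
    by_cases h₁ : FewGenerations t n η₁ d
    · rw [indicator_of_mem (show η₁ ∈ {η | FewGenerations t n η d} from h₁)]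
      exact indicator_one_congr (by simp [h₀, h₁])
    · rw [indicator_of_notMem (show η₁ ∉ {η | FewGenerations t n η d} from h₁),
        indicator_of_notMem fun h => h₁ h.1.2]
  · rw [indicator_of_notMem (show η₀ ∉ {η | FewGenerations t n η d} from h₀)]
    have : ∀ η₁, {z : (Word → ℝ × ℝ) × (Word → ℝ × ℝ) | (FewGenerations t n z.1 d ∧
        FewGenerations t n z.2 d) ∧ joinState b d (redState t n z.1 d) (redState t n z.2 d) ∈ A
        }.indicator (1 : (Word → ℝ × ℝ) × (Word → ℝ × ℝ) → ℝ≥0∞) (η₀, η₁) = 0 := fun η₁ =>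
      indicator_of_notMem (fun h => h₀ h.1.1) _
    simp [this]

lemma lintegral_treeNoise {F : (Word → ℝ × ℝ) → ℝ≥0∞} (hF : Measurable F) :
    ∫⁻ η, F η ∂(treeNoise μ) = ∫⁻ a, ∫⁻ x, ∫⁻ η₀, ∫⁻ η₁, F (graft (a, x) η₀ η₁)
      ∂(treeNoise μ) ∂(treeNoise μ) ∂μ ∂(expMeasure 1) := by
  have h : Measurable fun z : (ℝ × ℝ) × (Word → ℝ × ℝ) =>
      ∫⁻ η₁, F (graft z.1 z.2 η₁) ∂(treeNoise μ) :=
    Measurable.lintegral_prod_right' (f := fun z : ((ℝ × ℝ) × (Word → ℝ × ℝ)) × (Word → ℝ × ℝ) =>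
      F (graft z.1.1 z.1.2 z.2)) (hF.comp (measurable_graft.comp
        (measurable_fst.fst.prodMk (measurable_fst.snd.prodMk measurable_snd))))
  rw [treeNoise, lintegral_infinitePi_word _ hF, ← treeNoise,
    lintegral_prod _ h.lintegral_prod_right'.aemeasurable]

/-- Either the root outlives `t` and its label decides, or the state is the join of two independent
subtrees, both exhausted by `n` generations. -/
lemma redLaw_succ_le (n : ℕ) (b : ℝ) {A : Set (State t)} (hA : MeasurableSet A) :
    redLaw t μ (n + 1) b A ≤ yuleStep (redLaw t μ n) μ b (A.indicator 1) := by
  have hm : MeasurableSet {η | FewGenerations t (n + 1) η b ∧ redState t (n + 1) η b ∈ A} :=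
    (measurableSet_fewGenerations (n + 1) measurable_id measurable_const).inter
      (measurable_redState (n + 1) measurable_id measurable_const hA)
  rw [redLaw_apply _ _ hA, ← lintegral_indicator_one hm,
    lintegral_treeNoise (measurable_one.indicator hm)]
  refine lintegral_mono fun a => ?_
  simp only
  by_cases hat : b + a ≤ t
  · rw [if_pos hat, lintegral_lintegral_redLaw n b _ hA]
    refine (lintegral_mono (g := fun _ => _) fun x => ?_).trans
      ((lintegral_const _).trans (by rw [measure_univ, mul_one])).le
    refine lintegral_mono fun η₀ => lintegral_mono fun η₁ => le_of_eq ?_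
    exact indicator_one_congr (by
      simp only [mem_ofPred_eq, fewGenerations_graft, redState_graft, if_pos hat, not_lt.2 hat,
        false_or])
  · rw [if_neg hat]
    refine lintegral_mono fun x => ?_
    have h : ∀ η₀ η₁, {η | FewGenerations t (n + 1) η b ∧ redState t (n + 1) η b ∈ A}.indicator
        (1 : (Word → ℝ × ℝ) → ℝ≥0∞) (graft (a, x) η₀ η₁) = A.indicator 1 (leafState t b x) :=
      fun η₀ η₁ => indicator_one_congr (by
        simp only [mem_ofPred_eq, fewGenerations_graft, redState_graft, if_neg hat, not_le.1 hat,
          true_or, true_and])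
    simp [h]

/-- The iteration starts from the zero measure, and a monotone recursion stays below its invariant
family. -/
lemma IsFlow.redLaw_le {p lam : ℝ → ℝ} (hf : IsFlow p lam) (n : ℕ) {b : ℝ} (hb : b ≤ t) :
    redLaw t (initialLaw (p 0) (lam 0)) n b ≤ flowLaw p lam t b := by
  have := isProbabilityMeasure_initialLaw ⟨hf.p_nonneg 0, hf.p_lt_one _⟩ (hf.lam_pos 0)
  induction n generalizing b with
  | zero =>
    refine Measure.le_iff.2 fun A hA => ?_
    rw [redLaw_apply _ _ hA]
    simp [FewGenerations]
  | succ n ih =>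
    refine Measure.le_iff.2 fun A hA => ?_
    exact (redLaw_succ_le n b hA).trans
      ((yuleStep_mono (fun d _ hd => ih hd) _).trans (hf.yuleStep_indicator_le hb hA))

/-- First moment bound with exponential weight. The constant `3` is chosen so that a generation
costs the factor `2 E[e^{-3a}] = 2 / 4 = 1 / 2`, the `2` coming from the union bound over the
children. -/
lemma treeNoise_not_fewGenerations_le (n : ℕ) {b : ℝ} (hb : b ≤ t) :
    treeNoise μ {η | ¬ FewGenerations t n η b} ≤
      ENNReal.ofReal ((1 / 2) ^ n * Real.exp (3 * (t - b))) := by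
  induction n generalizing b with
  | zero =>
    refine prob_le_one.trans (ENNReal.one_le_ofReal.2 ?_)
    rw [pow_zero, one_mul]
    exact Real.one_le_exp (by linarith)
  | succ n ih =>
    have hm : MeasurableSet {η | ¬ FewGenerations t (n + 1) η b} :=
      (measurableSet_fewGenerations (n + 1) measurable_id measurable_const).compl
    have hmn : ∀ d, MeasurableSet {η | ¬ FewGenerations t n η d} := fun d =>
      (measurableSet_fewGenerations n measurable_id measurable_const).compl
    set C : ℝ := (1 / 2) ^ n * Real.exp (3 * (t - b)) with hC
    have hC0 : 0 ≤ C := by positivity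
    rw [← lintegral_indicator_one hm, lintegral_treeNoise (measurable_one.indicator hm)]
    have hstep : ∀ᵐ a ∂(expMeasure 1), ∫⁻ x, ∫⁻ η₀, ∫⁻ η₁,
        {η | ¬ FewGenerations t (n + 1) η b}.indicator 1 (graft (a, x) η₀ η₁)
          ∂(treeNoise μ) ∂(treeNoise μ) ∂μ ≤ ENNReal.ofReal (2 * C * Real.exp (-(3 * a))) := by
      filter_upwards [ae_expMeasure_pos] with a ha
      refine (lintegral_mono (g := fun _ => ENNReal.ofReal (2 * C * Real.exp (-(3 * a))))
        fun x => ?_).trans ((lintegral_const _).trans (by rw [measure_univ, mul_one])).le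
      by_cases hat : b + a ≤ t
      · have hle : ∀ η₀ η₁, {η | ¬ FewGenerations t (n + 1) η b}.indicator
            (1 : (Word → ℝ × ℝ) → ℝ≥0∞) (graft (a, x) η₀ η₁) ≤
            {η | ¬ FewGenerations t n η (b + a)}.indicator 1 η₀ +
              {η | ¬ FewGenerations t n η (b + a)}.indicator 1 η₁ := by
          intro η₀ η₁
          have hle1 : {η | ¬ FewGenerations t (n + 1) η b}.indicator
              (1 : (Word → ℝ × ℝ) → ℝ≥0∞) (graft (a, x) η₀ η₁) ≤ 1 :=
            indicator_le_self' (fun _ _ => zero_le) _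
          by_cases h₀ : FewGenerations t n η₀ (b + a)
          · by_cases h₁ : FewGenerations t n η₁ (b + a)
            · have hnot : graft (a, x) η₀ η₁ ∉ {η | ¬ FewGenerations t (n + 1) η b} :=
                not_not.2 (Or.inr ⟨h₀, h₁⟩)
              rw [indicator_of_notMem hnot]
              exact zero_le
            · rw [indicator_of_mem (s := {η | ¬ FewGenerations t n η (b + a)}) (a := η₁) h₁]
              exact hle1.trans le_add_self
          · rw [indicator_of_mem (s := {η | ¬ FewGenerations t n η (b + a)}) (a := η₀) h₀]
            exact hle1.trans le_self_add
        refine (lintegral_mono fun η₀ => lintegral_mono fun η₁ => hle η₀ η₁).trans ?_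
        have h1 : ∀ η₀ : Word → ℝ × ℝ, ∫⁻ η₁, ({η | ¬ FewGenerations t n η (b + a)}.indicator
            (1 : (Word → ℝ × ℝ) → ℝ≥0∞) η₀ +
            {η | ¬ FewGenerations t n η (b + a)}.indicator 1 η₁) ∂(treeNoise μ) =
            {η | ¬ FewGenerations t n η (b + a)}.indicator 1 η₀ +
            treeNoise μ {η | ¬ FewGenerations t n η (b + a)} := by
          intro η₀
          rw [lintegral_add_left measurable_const, lintegral_const, measure_univ, mul_one,
            lintegral_indicator_one (hmn _)]
        simp only [h1]
        rw [lintegral_add_right _ measurable_const, lintegral_const, measure_univ, mul_one,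
          lintegral_indicator_one (hmn _)]
        refine (add_le_add (ih hat) (ih hat)).trans ?_
        rw [← ENNReal.ofReal_add (by positivity) (by positivity)]
        refine ENNReal.ofReal_le_ofReal (le_of_eq ?_)
        rw [hC, show 3 * (t - (b + a)) = 3 * (t - b) + -(3 * a) by ring, Real.exp_add]
        ring
      · have hz : ∀ η₀ η₁, {η | ¬ FewGenerations t (n + 1) η b}.indicator
            (1 : (Word → ℝ × ℝ) → ℝ≥0∞) (graft (a, x) η₀ η₁) = 0 := fun η₀ η₁ => by
          simp [fewGenerations_graft, not_le.1 hat]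
        simp [hz]
    refine (lintegral_mono_ae hstep).trans (le_of_eq ?_)
    -- `e^{-a} e^{-3a}` is a quarter of the density of `expMeasure 4`, so the integral is read off
    -- from a total mass equal to one.
    have hprob := isProbabilityMeasure_expMeasure (r := 4) (by norm_num)
    have hone := lintegral_expMeasure 4 (h := fun _ => ENNReal.ofReal ((1 / 2) ^ (n + 1) *
      Real.exp (3 * (t - b)))) measurable_const
    rw [lintegral_const, measure_univ, mul_one] at hone
    rw [lintegral_expMeasure 1 (by fun_prop), hone]
    refine lintegral_congr fun a => ?_
    rw [← ENNReal.ofReal_mul (by positivity), ← ENNReal.ofReal_mul (by positivity)]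
    congr 1
    rw [hC, show -(4 * a) = -(1 * a) + -(3 * a) by ring, Real.exp_add]
    ring

lemma ae_exists_fewGenerations {b : ℝ} (hb : b ≤ t) :
    ∀ᵐ η ∂(treeNoise μ), ∃ n, FewGenerations t n η b := by
  have h : treeNoise μ {η | ¬ ∃ n, FewGenerations t n η b} = 0 := by
    refine le_antisymm (ge_of_tendsto' (x := Filter.atTop) (f := fun n : ℕ =>
      ENNReal.ofReal ((1 / 2) ^ n * Real.exp (3 * (t - b)))) ?_ fun n => ?_) zero_le
    · rw [← ENNReal.ofReal_zero]
      refine ENNReal.tendsto_ofReal ?_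
      rw [← zero_mul (Real.exp (3 * (t - b)))]
      exact (tendsto_pow_atTop_nhds_zero_of_lt_one (by norm_num) (by norm_num)).mul_const _
    · exact (measure_mono fun η (hη : ¬ ∃ n, FewGenerations t n η b) hn => hη ⟨n, hn⟩).trans
        (treeNoise_not_fewGenerations_le n hb)
  exact h

lemma ae_lifetime_pos : ∀ᵐ η ∂(treeNoise μ), ∀ w, 0 < (η w).1 := by
  refine ae_all_iff.2 fun w => ?_
  have h1 : ∀ᵐ z ∂((expMeasure 1).prod μ), 0 < z.1 :=
    (Measure.quasiMeasurePreserving_fst).ae ae_expMeasure_pos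
  exact (measurePreserving_eval_infinitePi (fun _ : Word => (expMeasure 1).prod μ)
    w).quasiMeasurePreserving.ae h1

end RedLaw

/-! ### Identification of the red tree with its recursive description -/

section StateFacts

variable {t : ℝ}

lemma splitPath_of_lt {c r : ℝ} (π₀ π₁ : Path t) {s : Icc (0 : ℝ) t} (h : (s : ℝ) < r) :
    splitPath c r π₀ π₁ s = linePath t c s := funext fun _ => if_pos h

lemma splitPath_nil_of_ge {c r : ℝ} (π₀ π₁ : Path t) {s : Icc (0 : ℝ) t} (h : r ≤ s) :
    splitPath c r π₀ π₁ s [] = none := if_neg (not_lt.2 h)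

lemma splitPath_cons_of_ge {c r : ℝ} (π₀ π₁ : Path t) {s : Icc (0 : ℝ) t} (h : r ≤ s) (i : Fin 2)
    (w : Word) : splitPath c r π₀ π₁ s (i :: w) = if i = 0 then π₀ s w else π₁ s w :=
  if_neg (not_lt.2 h)

lemma joinState_fst (b d : ℝ) (y₀ y₁ : State t) :
    (joinState b d y₀ y₁).1 = max (y₀.1 + y₁.1 - (d - b)) 0 := by
  by_cases h : y₀.1 + y₁.1 - (d - b) ≤ 0
  · rw [joinState, if_pos h]
    exact (max_eq_right h).symm
  · rw [joinState, if_neg h]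
    exact (max_eq_left (not_le.1 h).le).symm

lemma leafState_fst (b ξ : ℝ) : (leafState t b ξ).1 = max (ξ - (t - b)) 0 := by
  unfold leafState
  split_ifs with h
  · exact (max_eq_right h).symm
  · exact (max_eq_left (not_le.1 h).le).symm

lemma redState_fst_nonneg (n : ℕ) (η : Word → ℝ × ℝ) (b : ℝ) : 0 ≤ (redState t n η b).1 := by
  cases n with
  | zero => exact le_rfl
  | succ n =>
    rw [redState]
    split_ifs
    · exact (le_max_right _ _).trans_eq (joinState_fst _ _ _ _).symm
    · exact (le_max_right _ _).trans_eq (leafState_fst _ _).symm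

lemma redState_of_fst_nonpos (n : ℕ) (η : Word → ℝ × ℝ) (b : ℝ) (h : (redState t n η b).1 ≤ 0) :
    redState t n η b = emptyState t := by
  cases n with
  | zero => rfl
  | succ n =>
    rw [redState] at h ⊢
    split_ifs at h ⊢ with hb
    · rw [joinState_fst] at h
      exact if_pos ((le_max_left _ _).trans h)
    · rw [leafState_fst] at h
      exact if_pos ((le_max_left _ _).trans h)

/-- The path of a particle with positive mass before its death. -/
lemma redState_snd_of_lt_death (n : ℕ) (η : Word → ℝ × ℝ) (hη : ∀ w, 0 < (η w).1) (b : ℝ)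
    (h : 0 < (redState t n η b).1) (s : Icc (0 : ℝ) t) (hs : (s : ℝ) < b + (η []).1) :
    (redState t n η b).2 s = linePath t ((redState t n η b).1 - b) s := by
  induction n generalizing η b with
  | zero => exact absurd h (lt_irrefl _)
  | succ n ih =>
    rw [redState] at h ⊢
    split_ifs at h ⊢ with hb
    · rw [joinState_fst] at h
      have hx := (lt_max_iff.1 h).resolve_right (lt_irrefl _)
      rw [joinState, if_neg (not_le.2 hx)]
      set d := b + (η []).1 with hd
      set η₀ : Word → ℝ × ℝ := fun w => η (0 :: w) with hη₀
      set η₁ : Word → ℝ × ℝ := fun w => η (1 :: w) with hη₁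
      -- A time before `d` also precedes the deaths of the children, so the induction hypothesis
      -- applies to their paths extended before birth.
      have hlt : ∀ i : Fin 2, (s : ℝ) < d + (η [i]).1 := fun i => by linarith [hη [i]]
      by_cases h₀ : 0 < (redState t n η₀ d).1
      · by_cases h₁ : 0 < (redState t n η₁ d).1
        · simp only [if_pos h₀, if_pos h₁]
          rw [splitPath_of_lt _ _ hs]
          congr 1
          ring
        · have hz : (redState t n η₁ d).1 = 0 :=
            le_antisymm (not_lt.1 h₁) (redState_fst_nonneg _ _ _)
          simp only [if_pos h₀, if_neg h₁]
          rw [ih η₀ (fun w => hη _) d h₀ (hlt 0), hz]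
          congr 1
          ring
      · have hz : (redState t n η₀ d).1 = 0 :=
          le_antisymm (not_lt.1 h₀) (redState_fst_nonneg _ _ _)
        have h₁ : 0 < (redState t n η₁ d).1 := by linarith [hη []]
        simp only [if_neg h₀]
        rw [ih η₁ (fun w => hη _) d h₁ (hlt 1), hz]
        congr 1
        ring
    · rw [leafState_fst] at h
      have hx := (lt_max_iff.1 h).resolve_right (lt_irrefl _)
      rw [leafState, if_neg (not_le.2 hx)]
      rw [show (η []).2 - t = (η []).2 - (t - b) - b by ring]

end StateFacts

section RedTree

variable {t : ℝ} {e ξ : Word → ℝ}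

/-- The lifetimes and labels of the descendants of `v`. -/
def subtree (e ξ : Word → ℝ) (v : Word) : Word → ℝ × ℝ := fun w => (e (v ++ w), ξ (v ++ w))

lemma subtree_cons (v : Word) (i : Fin 2) :
    (fun w => subtree e ξ v (i :: w)) = subtree e ξ (v ++ [i]) := by
  funext w
  simp [subtree]

lemma birth_add_subtree (v : Word) : birth e v + (subtree e ξ v []).1 = death e v := by
  simp [subtree, death]

lemma birth_le_birth_append (he : ∀ w, 0 < e w) (v u : Word) : birth e v ≤ birth e (v ++ u) := by
  induction u generalizing v with
  | nil => simp
  | cons i u ih =>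
    have h := ih (v ++ [i])
    rw [birth_child, List.append_assoc, List.singleton_append] at h
    exact (le_add_of_nonneg_right (he v).le).trans h

lemma death_le_birth_append (he : ∀ w, 0 < e w) (v : Word) (i : Fin 2) (u : Word) :
    death e v ≤ birth e (v ++ i :: u) := by
  have h := birth_le_birth_append he (v ++ [i]) u
  rwa [birth_child, List.append_assoc, List.singleton_append] at h

lemma birth_nonneg (he : ∀ w, 0 < e w) (v : Word) : 0 ≤ birth e v :=
  Finset.sum_nonneg fun _ _ => (he _).le

lemma FewGenerations.lt_birth (he : ∀ w, 0 < e w) {n : ℕ} {v : Word}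
    (h : FewGenerations t n (subtree e ξ v) (birth e v)) {u : Word} (hu : n ≤ u.length) :
    t < birth e (v ++ u) := by
  induction n generalizing v u with
  | zero => exact h.elim
  | succ n ih =>
    match u with
    | [] => simp at hu
    | i :: u =>
      rw [FewGenerations, subtree_cons, subtree_cons, birth_add_subtree] at h
      rcases h with h | h
      · exact h.trans_le (death_le_birth_append he v i u)
      · rw [List.append_cons]
        have hu' : n ≤ u.length := by simpa using hu
        rw [← birth_child e v 0] at h
        fin_cases i
        · exact ih h.1 hu'
        · have h1 := h.2
          rw [birth_child, ← birth_child e v 1] at h1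
          exact ih h1 hu'

lemma finite_bornBefore (he : ∀ w, 0 < e w) {n : ℕ}
    (h : FewGenerations t n (subtree e ξ []) 0) : (bornBefore e t).Finite := by
  refine (List.finite_length_lt (Fin 2) n).subset fun u hu => ?_
  by_contra hn
  have h' : FewGenerations t n (subtree e ξ []) (birth e []) := by simpa [birth] using h
  exact absurd (h'.lt_birth he (not_lt.1 hn)) (not_lt.2 hu)

/-- The mass of `v` at its birth in the Derrida-Retaux tree. -/
def birthMass (t : ℝ) (e ξ : Word → ℝ) (v : Word) : ℝ := drTree t e ξ (birth e v) v

lemma drTree_of_death_le (h : (bornBefore e t).Finite) (s : ℝ) {v : Word} (hv : death e v ≤ t) :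
    drTree t e ξ s v =
      max (birthMass t e ξ (v ++ [0]) + birthMass t e ξ (v ++ [1]) - (death e v - s)) 0 :=
  drTree_branch ξ h s hv

/-- On a branch the mass is the positive part of a function of slope one: if positive at birth, it
remains so and grows linearly. -/
lemma exists_drTree_eq (h : (bornBefore e t).Finite) (v : Word) :
    ∃ K, ∀ s, drTree t e ξ s v = max (K + s) 0 := by
  by_cases hv : death e v ≤ t
  · refine ⟨birthMass t e ξ (v ++ [0]) + birthMass t e ξ (v ++ [1]) - death e v, fun s => ?_⟩
    rw [drTree_of_death_le h s hv]
    congr 1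
    ring
  · refine ⟨ξ v - t, fun s => ?_⟩
    rw [drTree_leaf ξ s (not_le.1 hv)]
    congr 1
    ring

lemma drTree_of_birthMass_pos (h : (bornBefore e t).Finite) {v : Word}
    (hv : 0 < birthMass t e ξ v) {s : ℝ} (hs : birth e v ≤ s) :
    drTree t e ξ s v = birthMass t e ξ v - birth e v + s := by
  obtain ⟨K, hK⟩ := exists_drTree_eq (ξ := ξ) h v
  rw [birthMass, hK] at hv ⊢
  rw [hK]
  have h1 := (lt_max_iff.1 hv).resolve_right (lt_irrefl _)
  rw [max_eq_left h1.le, max_eq_left (by linarith)]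
  ring

lemma redState_fst (h : (bornBefore e t).Finite) {n : ℕ} {v : Word}
    (hn : FewGenerations t n (subtree e ξ v) (birth e v)) :
    (redState t n (subtree e ξ v) (birth e v)).1 = birthMass t e ξ v := by
  induction n generalizing v with
  | zero => exact hn.elim
  | succ n ih =>
    rw [FewGenerations, subtree_cons, subtree_cons, birth_add_subtree] at hn
    rw [redState, subtree_cons, subtree_cons, birth_add_subtree]
    split_ifs with hd
    · obtain ⟨h₀, h₁⟩ := hn.resolve_left (not_lt.2 hd)
      have i₀ := ih (v := v ++ [0]) (by rwa [birth_child])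
      have i₁ := ih (v := v ++ [1]) (by rwa [birth_child])
      rw [birth_child] at i₀ i₁
      change _ = drTree t e ξ (birth e v) v
      rw [joinState_fst, i₀, i₁, drTree_of_death_le h _ hd]
    · rw [leafState_fst, birthMass, drTree_leaf ξ _ (not_le.1 hd)]
      simp [subtree]

/-- The descendant `v ++ u` of `v` is alive at time `s` and all the individuals from `v` to `v ++ u`
have positive mass at their birth. -/
def RedFrom (t : ℝ) (e ξ : Word → ℝ) : Word → Word → ℝ → Prop
  | v, [], s => v ∈ alive e s ∧ 0 < birthMass t e ξ v
  | v, i :: u, s => 0 < birthMass t e ξ v ∧ RedFrom t e ξ (v ++ [i]) u s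

open Classical in
/-- The letters of the red label of `v ++ u` coming from the splittings of `v` and of its
descendants. -/
def labelFrom (t : ℝ) (e ξ : Word → ℝ) : Word → Word → Word
  | _, [] => []
  | v, i :: u => if VisibleSplit t e ξ v then i :: labelFrom t e ξ (v ++ [i]) u
    else labelFrom t e ξ (v ++ [i]) u

lemma RedFrom.birthMass_pos {v u : Word} {s : ℝ} (h : RedFrom t e ξ v u s) :
    0 < birthMass t e ξ v := by
  cases u with
  | nil => exact h.2
  | cons i u => exact h.1

lemma redFrom_iff {v u : Word} {s : ℝ} :
    RedFrom t e ξ v u s ↔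
      v ++ u ∈ alive e s ∧ ∀ u', u' <+: u → 0 < birthMass t e ξ (v ++ u') := by
  induction u generalizing v with
  | nil => simp [RedFrom]
  | cons i u ih =>
    rw [RedFrom, ih]
    simp only [List.append_assoc, List.singleton_append, List.prefix_cons_iff]
    constructor
    · rintro ⟨h1, h2, h3⟩
      refine ⟨h2, ?_⟩
      rintro u' (rfl | ⟨w, rfl, hw⟩)
      · simpa using h1
      · exact h3 w hw
    · rintro ⟨h1, h2⟩
      exact ⟨by simpa using h2 [] (Or.inl rfl), h1, fun w hw => h2 _ (Or.inr ⟨w, rfl, hw⟩)⟩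

/-- Since masses grow along branches, positivity at all earlier times need only be tested at births;
positive lifetimes ensure that each ancestor is alive when it is born. -/
lemma mem_red_iff (he : ∀ w, 0 < e w) (h : (bornBefore e t).Finite) {u : Word} {s : ℝ} :
    u ∈ red t e ξ s ↔ RedFrom t e ξ [] u s := by
  rw [redFrom_iff]
  refine and_congr_right fun hu => ?_
  constructor
  · rintro hr v ⟨w, rfl⟩
    refine hr (birth e v) (birth_nonneg he v) ((birth_le_birth_append he v w).trans hu.1) v
      ⟨w, rfl⟩ ⟨le_rfl, lt_add_of_pos_right _ (he v)⟩
  · intro hv r hr0 hrs v hvu hvr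
    have hpos : 0 < birthMass t e ξ v := hv v hvu
    rw [drTree_of_birthMass_pos h hpos hvr.1]
    linarith [hvr.1]

lemma redLabel_eq (u : Word) : redLabel t e ξ u = labelFrom t e ξ [] u := by
  classical
  -- The induction must remember the prefix `v` already read; the offset `v.length` keeps the
  -- positions relative to the whole word.
  have key : ∀ (u v : Word), (u.zipIdx v.length).filterMap
      (fun a => if VisibleSplit t e ξ ((v ++ u).take a.2) then some a.1 else none) =
      labelFrom t e ξ v u := by
    intro u
    induction u with
    | nil => intro v; rfl
    | cons i u ih =>
      intro v
      have h := ih (v ++ [i])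
      rw [List.length_append, List.length_singleton, List.append_assoc, List.singleton_append] at h
      rw [List.zipIdx_cons, List.filterMap_cons, h, List.take_left, labelFrom]
      by_cases hv : VisibleSplit t e ξ v <;> simp [hv]
  have h := key u []
  simp only [List.length_nil, List.nil_append] at h
  rw [← h, redLabel]

lemma visibleSplit_iff (v : Word) : VisibleSplit t e ξ v ↔
    0 < birthMass t e ξ (v ++ [0]) ∧ 0 < birthMass t e ξ (v ++ [1]) := Fin.forall_fin_two

/-- The masses of the red particles descending from `v` are given by `redState`. -/
lemma redState_snd_eq_some_iff (he : ∀ w, 0 < e w) (h : (bornBefore e t).Finite) {n : ℕ} {v : Word}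
    (hn : FewGenerations t n (subtree e ξ v) (birth e v)) (hv : 0 < birthMass t e ξ v)
    (s : Icc (0 : ℝ) t) (hs : birth e v ≤ s) (w : Word) (m : ℝ) :
    (redState t n (subtree e ξ v) (birth e v)).2 s w = some m ↔
      ∃ u, RedFrom t e ξ v u s ∧ labelFrom t e ξ v u = w ∧ drTree t e ξ s (v ++ u) = m := by
  induction n generalizing v w with
  | zero => exact hn.elim
  | succ n ih =>
    -- Before the death of `v`, it is the only possible red particle of its subtree. Afterwards the
    -- red particles descend from the children with positive mass.
    by_cases hsd : (s : ℝ) < death e v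
    · have hfst := redState_fst h hn
      rw [redState_snd_of_lt_death (n + 1) _ (fun w => he _) _ (by rwa [hfst]) s
        (by rwa [birth_add_subtree]), hfst, linePath]
      have hno : ∀ i u, ¬ RedFrom t e ξ v (i :: u) s := fun i u hr =>
        absurd (hsd.trans_le (death_le_birth_append he v i u)) (not_lt.2 (redFrom_iff.1 hr).1.1)
      constructor
      · intro hw
        split_ifs at hw with hw0
        refine ⟨[], ⟨⟨hs, hsd⟩, hv⟩, hw0.symm, ?_⟩
        rw [List.append_nil, drTree_of_birthMass_pos h hv hs]
        exact Option.some.inj hw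
      · rintro ⟨u, hr, rfl, hm⟩
        match u with
        | [] =>
          rw [List.append_nil, drTree_of_birthMass_pos h hv hs] at hm
          simp [labelFrom, hm]
        | i :: u => exact absurd hr (hno i u)
    · rw [not_lt] at hsd
      have hd : death e v ≤ t := hsd.trans s.2.2
      rw [FewGenerations, subtree_cons, subtree_cons, birth_add_subtree] at hn
      rw [redState, subtree_cons, subtree_cons, birth_add_subtree, if_pos hd]
      obtain ⟨hn₀, hn₁⟩ := hn.resolve_left (not_lt.2 hd)
      have f₀ := redState_fst h (v := v ++ [0]) (n := n) (by rwa [birth_child])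
      have f₁ := redState_fst h (v := v ++ [1]) (n := n) (by rwa [birth_child])
      have i₀ := fun w hv => ih (v := v ++ [0]) (by rwa [birth_child]) hv (by rwa [birth_child]) w
      have i₁ := fun w hv => ih (v := v ++ [1]) (by rwa [birth_child]) hv (by rwa [birth_child]) w
      rw [birth_child] at f₀ f₁
      simp only [birth_child] at i₀ i₁
      have hx : 0 < birthMass t e ξ (v ++ [0]) + birthMass t e ξ (v ++ [1]) -
          (death e v - birth e v) := by
        rw [birthMass, drTree_of_death_le h _ hd] at hv
        exact (lt_max_iff.1 hv).resolve_right (lt_irrefl _)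
      have hnil : ¬ RedFrom t e ξ v [] s := fun hr => absurd hr.1.2 (not_lt.2 hsd)
      rw [joinState, f₀, f₁, if_neg (not_le.2 hx)]
      by_cases h₀ : 0 < birthMass t e ξ (v ++ [0])
      · by_cases h₁ : 0 < birthMass t e ξ (v ++ [1])
        · have hvis : VisibleSplit t e ξ v := (visibleSplit_iff v).2 ⟨h₀, h₁⟩
          simp only [if_pos h₀, if_pos h₁]
          match w with
          | [] =>
            rw [splitPath_nil_of_ge _ _ hsd]
            simp only [reduceCtorEq, false_iff]
            rintro ⟨u, hr, hl, -⟩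
            match u with
            | [] => exact hnil hr
            | i :: u => simp [labelFrom, hvis] at hl
          | i :: w =>
            have key : ∀ i : Fin 2, (∃ u, RedFrom t e ξ v u s ∧ labelFrom t e ξ v u = i :: w ∧
                drTree t e ξ s (v ++ u) = m) ↔ ∃ u, RedFrom t e ξ (v ++ [i]) u s ∧
                labelFrom t e ξ (v ++ [i]) u = w ∧ drTree t e ξ s (v ++ [i] ++ u) = m := by
              intro i
              constructor
              · rintro ⟨u, hr, hl, hm⟩
                match u with
                | [] => exact absurd hr hnil
                | j :: u =>
                  simp only [labelFrom, hvis, if_true, List.cons.injEq] at hl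
                  obtain ⟨rfl, hl⟩ := hl
                  exact ⟨u, hr.2, hl, by rwa [← List.append_cons]⟩
              · rintro ⟨u, hr, hl, hm⟩
                refine ⟨i :: u, ⟨hv, hr⟩, ?_, by rwa [List.append_cons]⟩
                simp only [labelFrom, hvis, if_true, hl]
            rw [splitPath_cons_of_ge _ _ hsd, key i]
            fin_cases i
            · exact i₀ w h₀
            · exact i₁ w h₁
        -- The letter of an invisible splitting is erased, so red descendants keep their labels when
        -- `v` is replaced by the child carrying mass.
        · have hvis : ¬ VisibleSplit t e ξ v := fun hvis => h₁ ((visibleSplit_iff v).1 hvis).2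
          simp only [if_pos h₀, if_neg h₁]
          rw [i₀ w h₀]
          constructor
          · rintro ⟨u, hr, hl, hm⟩
            refine ⟨0 :: u, ⟨hv, hr⟩, ?_, by rwa [List.append_cons]⟩
            simp only [labelFrom, hvis, if_false, hl]
          · rintro ⟨u, hr, hl, hm⟩
            match u with
            | [] => exact absurd hr hnil
            | 0 :: u =>
              simp only [labelFrom, hvis, if_false] at hl
              exact ⟨u, hr.2, hl, by rwa [← List.append_cons]⟩
            | 1 :: u => exact absurd hr.2.birthMass_pos h₁
      · have hvis : ¬ VisibleSplit t e ξ v := fun hvis => h₀ ((visibleSplit_iff v).1 hvis).1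
        have h₁ : 0 < birthMass t e ξ (v ++ [1]) := by
          have : 0 < death e v - birth e v := by simpa [death] using he v
          linarith
        simp only [if_neg h₀]
        rw [i₁ w h₁]
        constructor
        · rintro ⟨u, hr, hl, hm⟩
          refine ⟨1 :: u, ⟨hv, hr⟩, ?_, by rwa [List.append_cons]⟩
          simp only [labelFrom, hvis, if_false, hl]
        · rintro ⟨u, hr, hl, hm⟩
          match u with
          | [] => exact absurd hr hnil
          | 0 :: u => exact absurd hr.2.birthMass_pos h₀
          | 1 :: u =>
            simp only [labelFrom, hvis, if_false] at hl
            exact ⟨u, hr.2, hl, by rwa [← List.append_cons]⟩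

/-- `redState_snd_eq_some_iff` allows a single mass for each label and time, so the choice of a
representative in `redTree` is harmless. If the root has no mass, nothing is red. -/
lemma redState_eq (he : ∀ w, 0 < e w) {n : ℕ} (hn : FewGenerations t n (subtree e ξ []) 0) :
    redState t n (subtree e ξ []) 0 = (drTree t e ξ 0 [], redPath t e ξ) := by
  have h := finite_bornBefore he hn
  have hb : birth e [] = 0 := by simp [birth]
  have hn' : FewGenerations t n (subtree e ξ []) (birth e []) := by rwa [hb]
  have hfst : (redState t n (subtree e ξ []) 0).1 = birthMass t e ξ [] := by
    rw [← redState_fst h hn', hb]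
  refine Prod.ext (by rw [hfst, birthMass, hb]) ?_
  funext s w
  by_cases hv : 0 < birthMass t e ξ []
  · have key := redState_snd_eq_some_iff he h hn' hv s (by rw [hb]; exact s.2.1) w
    rw [hb] at key
    simp only [List.nil_append] at key
    change _ = redTree t e ξ s w
    rw [redTree]
    split_ifs with hu
    · have hspec := hu.choose_spec
      exact (key _).2 ⟨hu.choose, (mem_red_iff he h).1 hspec.1, by rw [← redLabel_eq, hspec.2], rfl⟩
    · rw [Option.eq_none_iff_forall_ne_some]
      intro m hm
      obtain ⟨u, hr, hl, -⟩ := (key m).1 hm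
      exact hu ⟨u, (mem_red_iff he h).2 hr, by rw [redLabel_eq, hl]⟩
  · change _ = redTree t e ξ s w
    rw [redState_of_fst_nonpos _ _ _ (by rw [hfst]; exact not_lt.1 hv), redTree, dif_neg]
    · rfl
    · rintro ⟨u, hu, -⟩
      exact hv ((mem_red_iff he h).1 hu).birthMass_pos

end RedTree

/-! ### The law of the red tree -/

section Law

variable {t : ℝ} {p lam : ℝ → ℝ}

/-- The mass of the root of the Derrida-Retaux tree together with the red tree. -/
def redPair (t : ℝ) (η : Word → ℝ × ℝ) : State t :=
  (drTree t (fun u => (η u).1) (fun u => (η u).2) 0 [],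
    redPath t (fun u => (η u).1) (fun u => (η u).2))

lemma ae_redState_eq_redPair (μ : Measure ℝ) [IsProbabilityMeasure μ] :
    ∀ᵐ η ∂(treeNoise μ), ∀ n, FewGenerations t n η 0 → redState t n η 0 = redPair t η := by
  filter_upwards [ae_lifetime_pos] with η hη n hn
  exact redState_eq (e := fun u => (η u).1) (ξ := fun u => (η u).2) hη hn

/-- The definition of the red tree involves a choice, so measurability is not read off from it;
almost surely one of countably many events holds on which `redPair` agrees with a measurable
`redState`. -/
lemma aemeasurable_redPair (ht : 0 ≤ t) (μ : Measure ℝ) [IsProbabilityMeasure μ] :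
    AEMeasurable (redPair t) (treeNoise μ) := by
  have hU : (treeNoise μ).restrict (⋃ n, {η | FewGenerations t n η 0}) = treeNoise μ := by
    refine Measure.restrict_eq_self_of_ae_mem ?_
    filter_upwards [ae_exists_fewGenerations ht] with η hη
    exact mem_iUnion.2 hη
  rw [← hU, aemeasurable_iUnion_iff]
  intro n
  have hm : Measurable fun η => redState t n η 0 :=
    measurable_redState n measurable_id measurable_const
  refine hm.aemeasurable.congr ?_
  filter_upwards [ae_restrict_of_ae (ae_redState_eq_redPair (t := t) μ),
    ae_restrict_mem (measurableSet_fewGenerations n measurable_id measurable_const)] with η h hn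
  exact h n hn

/-- Let the number of explored generations increase in `IsFlow.redLaw_le`. The limit is a
probability measure below another one, hence equal to it. -/
lemma IsFlow.map_redPair (hf : IsFlow p lam) (ht : 0 ≤ t) :
    (treeNoise (initialLaw (p 0) (lam 0))).map (redPair t) = flowLaw p lam t 0 := by
  have := isProbabilityMeasure_initialLaw ⟨hf.p_nonneg 0, hf.p_lt_one _⟩ (hf.lam_pos 0)
  have := hf.isProbabilityMeasure_flowLaw (t := t) 0
  have hm := aemeasurable_redPair ht (initialLaw (p 0) (lam 0))
  have := Measure.isProbabilityMeasure_map hm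
  refine Measure.eq_of_le_of_isProbabilityMeasure (Measure.le_iff.2 fun A hA => ?_)
  rw [Measure.map_apply_of_aemeasurable hm hA]
  set B : ℕ → Set (Word → ℝ × ℝ) := fun n => {η | FewGenerations t n η 0 ∧ redPair t η ∈ A}
  have hB : Monotone B := monotone_nat_of_le_succ fun n η hη => ⟨hη.1.succ, hη.2⟩
  have hsub : treeNoise (initialLaw (p 0) (lam 0)) (redPair t ⁻¹' A) ≤
      treeNoise (initialLaw (p 0) (lam 0)) (⋃ n, B n) := by
    refine measure_mono_ae ?_
    filter_upwards [ae_exists_fewGenerations ht] with η hη hA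
    obtain ⟨n, hn⟩ := hη
    exact mem_iUnion.2 ⟨n, hn, hA⟩
  refine hsub.trans ?_
  rw [hB.measure_iUnion]
  refine iSup_le fun n => ?_
  refine le_trans (measure_mono_ae ?_) ((redLaw_apply n 0 hA).symm.trans_le (hf.redLaw_le n ht A))
  filter_upwards [ae_redState_eq_redPair (t := t) (initialLaw (p 0) (lam 0))] with η h hη
  refine ⟨hη.1, ?_⟩
  rw [h n hη.1]
  exact hη.2

/-- The kernel giving the law on paths of the branching process started at time `0`. -/
def branchKernel (t : ℝ) (ρ : ℝ → ℝ) : Kernel ℝ (Path t) :=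
  (Kernel.id ×ₖ Kernel.const ℝ noise).map fun z => (startState t ρ 0 z.1 z.2).2

lemma IsFlow.isMarkovKernel_branchKernel (hf : IsFlow p lam) :
    IsMarkovKernel (branchKernel t (rateOf p lam)) :=
  Kernel.IsMarkovKernel.map _
    (measurable_startState hf.continuous_rateOf hf.rateOf_pos 0).snd

lemma IsFlow.branchKernel_apply (hf : IsFlow p lam) {x : ℝ} (hx : 0 < x) :
    branchKernel t (rateOf p lam) x = noise.map (branchPath t (rateOf p lam) 0 x) := by
  have hm := (measurable_startState (t := t) hf.continuous_rateOf hf.rateOf_pos 0).snd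
  rw [branchKernel, Kernel.map_apply _ hm, Kernel.prod_apply, Kernel.id_apply, Kernel.const_apply,
    Measure.dirac_prod, Measure.map_map hm measurable_prodMk_left]
  congr 1
  funext Z
  simp [startState, not_le.2 hx]

/-- On the event that the mass of the root is positive, the law of the pair is the composition of
the law of the mass with the branching kernel. -/
lemma IsFlow.flowLaw_restrict (hf : IsFlow p lam) :
    (flowLaw p lam t 0).restrict (Ioi 0 ×ˢ univ) =
      (initialLaw (p t) (lam t)).restrict (Ioi 0) ⊗ₘ branchKernel t (rateOf p lam) := by
  have := isProbabilityMeasure_initialLaw ⟨hf.p_nonneg t, hf.p_lt_one _⟩ (hf.lam_pos t)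
  have := hf.isMarkovKernel_branchKernel (t := t)
  have hs := measurable_startState (t := t) hf.continuous_rateOf hf.rateOf_pos 0
  have hS : MeasurableSet ((Ioi (0 : ℝ)) ×ˢ (univ : Set (Path t))) :=
    measurableSet_Ioi.prod MeasurableSet.univ
  ext B hB
  rw [Measure.restrict_apply hB, flowLaw, sub_zero, Measure.map_apply hs (hB.inter hS),
    Measure.prod_apply (hs (hB.inter hS)), Measure.compProd_apply hB,
    ← lintegral_indicator measurableSet_Ioi]
  refine lintegral_congr fun x => ?_
  by_cases hx : 0 < x
  · have hb : Measurable (branchPath t (rateOf p lam) 0 x) :=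
      measurable_branchPath hf.continuous_rateOf hf.rateOf_pos measurable_const measurable_const
        measurable_id
    rw [indicator_of_mem (show x ∈ Ioi 0 from hx), hf.branchKernel_apply hx,
      Measure.map_apply hb (measurable_prodMk_left hB)]
    congr 1
    ext Z
    simp [startState, not_le.2 hx, hx]
  · rw [indicator_of_notMem (show x ∉ Ioi 0 from hx)]
    have : Prod.mk x ⁻¹' ((fun z : ℝ × (Word → ℝ × I) => startState t (rateOf p lam) 0 z.1 z.2) ⁻¹'
        (B ∩ (Ioi (0 : ℝ)) ×ˢ (univ : Set (Path t)))) = ∅ := by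
      ext Z
      simp [startState, not_lt.1 hx, emptyState]
    rw [this, measure_empty]

lemma initialLaw_Ioi_pos {q l : ℝ} (hq : q < 1) (hl : 0 < l) : 0 < initialLaw q l (Ioi 0) := by
  have hone : expMeasure l (Ioi 0) = 1 := by
    have := isProbabilityMeasure_expMeasure hl
    rw [← lintegral_indicator_one measurableSet_Ioi,
      lintegral_expMeasure l (measurable_one.indicator measurableSet_Ioi),
      setLIntegral_congr_fun (g := fun x => ENNReal.ofReal (l * Real.exp (-(l * x))) * 1)
        measurableSet_Ioi fun x hx => by
          simp only [indicator_of_mem hx, Pi.one_apply]]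
    rw [← lintegral_expMeasure l measurable_const, lintegral_const, measure_univ, one_mul]
  rw [initialLaw, Measure.add_apply, Measure.smul_apply, Measure.smul_apply, hone, smul_eq_mul,
    smul_eq_mul, mul_one]
  exact (ENNReal.ofReal_pos.2 (sub_pos.2 hq)).trans_le le_add_self

end Law

/-! ### Independent pairs -/

/-- Reindex the independent family from `Word ⊕ Word` to `Word × Fin 2`, curry, and identify `Fin 2
→ ℝ` with pairs. -/
lemma map_pair_eq_treeNoise {Ω : Type*} [MeasurableSpace Ω] {P : Measure Ω} {μ : Measure ℝ}
    [IsProbabilityMeasure P] [IsProbabilityMeasure μ] {e ξ : Word → Ω → ℝ}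
    (he : ∀ u, HasLaw (e u) (expMeasure 1) P) (hξ : ∀ u, HasLaw (ξ u) μ P)
    (hindep : iIndepFun (Sum.elim e ξ) P) :
    P.map (fun ω u => (e u ω, ξ u ω)) = treeNoise μ := by
  let ν : Fin 2 → Measure ℝ := ![expMeasure 1, μ]
  have hν : ∀ j, IsProbabilityMeasure (ν j) := by
    intro j
    fin_cases j
    · exact inferInstanceAs (IsProbabilityMeasure (expMeasure 1))
    · exact inferInstanceAs (IsProbabilityMeasure μ)
  let g : Word × Fin 2 → Word ⊕ Word := fun q => if q.2 = 0 then Sum.inl q.1 else Sum.inr q.1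
  have hg : g.Injective := by
    rintro ⟨u, i⟩ ⟨v, j⟩ h
    fin_cases i <;> fin_cases j <;> simp_all [g]
  have hlaw : ∀ q : Word × Fin 2, HasLaw (Sum.elim e ξ (g q)) (ν q.2) P := by
    rintro ⟨u, i⟩
    fin_cases i
    · exact he u
    · exact hξ u
  have hY : AEMeasurable (fun ω (q : Word × Fin 2) => Sum.elim e ξ (g q) ω) P :=
    aemeasurable_pi_iff.2 fun q => (hlaw q).aemeasurable
  have h1 := ((hindep.precomp hg).hasLaw_infinitePi hlaw hY).map_eq
  have h2 := Measure.infinitePi_map_curry fun (_ : Word) (j : Fin 2) => ν j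
  have h3 : ∀ _ : Word, Measurable (MeasurableEquiv.finTwoArrow : (Fin 2 → ℝ) ≃ᵐ ℝ × ℝ) :=
    fun _ => MeasurableEquiv.measurable _
  have h4 := Measure.infinitePi_map_pi (μ := fun _ : Word => Measure.infinitePi ν) h3
  have h5 : (Measure.infinitePi ν).map (MeasurableEquiv.finTwoArrow : (Fin 2 → ℝ) ≃ᵐ ℝ × ℝ) =
      (expMeasure 1).prod μ := by
    rw [Measure.infinitePi_eq_pi]
    exact (measurePreserving_finTwoArrow_vec (expMeasure 1) μ).map_eq
  have h6 : Measurable fun (x : Word → Fin 2 → ℝ) u =>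
      (MeasurableEquiv.finTwoArrow : (Fin 2 → ℝ) ≃ᵐ ℝ × ℝ) (x u) := by
    fun_prop
  simp only [h5] at h4
  rw [treeNoise, ← h4, ← h2, ← h1, AEMeasurable.map_map_of_aemeasurable
    (MeasurableEquiv.measurable _).aemeasurable hY, AEMeasurable.map_map_of_aemeasurable
    h6.aemeasurable ((MeasurableEquiv.measurable _).comp_aemeasurable hY)]
  rfl

end DerridaRetaux

end

/-! ### Conditional law of the red tree given the mass of the root -/

open DerridaRetaux
theorem mainTheorem9 {Ω : Type*} [MeasurableSpace Ω] (P : Measure Ω) [IsProbabilityMeasure P]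
    (t : ℝ) (ht : 0 < t) (p lam : ℝ → ℝ)
    (hp0 : p 0 ∈ Ico (0 : ℝ) 1) (hlam0 : 0 < lam 0)
    (hp : ∀ s, 0 ≤ s → HasDerivWithinAt p ((1 - p s) * (lam s - p s)) (Ici 0) s)
    (hlam : ∀ s, 0 ≤ s → HasDerivWithinAt lam (-lam s * (1 - p s)) (Ici 0) s)
    (e ξ : Word → Ω → ℝ)
    (he : ∀ u, HasLaw (e u) (expMeasure 1) P)
    (hξ : ∀ u, HasLaw (ξ u) (initialLaw (p 0) (lam 0)) P)
    (hindep : iIndepFun (Sum.elim e ξ) P) :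
    let ρ : ℝ → ℝ := fun s => (1 - p s) * lam s
    let X₀ : Ω → ℝ := fun ω => drTree t (fun u => e u ω) (fun u => ξ u ω) 0 []
    let 𝔛 : Ω → Path t := fun ω => redPath t (fun u => e u ω) (fun u => ξ u ω)
    AEMeasurable X₀ P ∧ AEMeasurable 𝔛 P ∧ 0 < P {ω | 0 < X₀ ω} ∧
    (∀ x, 0 < x → AEMeasurable (branchingPath t ρ x) noise) ∧
    ∃ κ : Kernel ℝ (Path t), IsMarkovKernel κ ∧ (∀ x, 0 < x → κ x = branchingLaw t ρ x) ∧
      P[|{ω | 0 < X₀ ω}].map (fun ω => (X₀ ω, 𝔛 ω)) = P[|{ω | 0 < X₀ ω}].map X₀ ⊗ₘ κ := by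
  intro ρ X₀ 𝔛
  have hf := isFlow_extend hp0 hlam0 hp hlam
  set q : ℝ → ℝ := fun s => p (max s 0) with hq
  set l : ℝ → ℝ := fun s => lam (max s 0) with hl
  have hq0 : q 0 = p 0 := by simp [hq]
  have hl0 : l 0 = lam 0 := by simp [hl]
  have hρ : ∀ s, 0 ≤ s → ρ s = rateOf q l s := fun s hs => by
    simp [ρ, rateOf, hq, hl, max_eq_left hs]
  have hμ : IsProbabilityMeasure (initialLaw (p 0) (lam 0)) :=
    isProbabilityMeasure_initialLaw hp0 hlam0
  have hlaw := map_pair_eq_treeNoise he hξ hindep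
  have hηm : AEMeasurable (fun ω u => (e u ω, ξ u ω)) P :=
    aemeasurable_pi_iff.2 fun u => (he u).aemeasurable.prodMk (hξ u).aemeasurable
  have hred := aemeasurable_redPair ht.le (initialLaw (p 0) (lam 0))
  rw [← hlaw] at hred
  have hY : AEMeasurable (fun ω => (X₀ ω, 𝔛 ω)) P := hred.comp_aemeasurable hηm
  have hX : AEMeasurable X₀ P := measurable_fst.comp_aemeasurable hY
  have hPY : P.map (fun ω => (X₀ ω, 𝔛 ω)) = flowLaw q l t 0 := by
    have h := hf.map_redPair ht.le
    rw [hq0, hl0, ← hlaw, AEMeasurable.map_map_of_aemeasurable hred hηm] at h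
    exact h
  have hS : MeasurableSet ((Ioi (0 : ℝ)) ×ˢ (univ : Set (Path t))) :=
    measurableSet_Ioi.prod MeasurableSet.univ
  have hκ := hf.isMarkovKernel_branchKernel (t := t)
  have hπ := isProbabilityMeasure_initialLaw ⟨hf.p_nonneg t, hf.p_lt_one _⟩ (hf.lam_pos t)
  have hpre : (fun ω => (X₀ ω, 𝔛 ω)) ⁻¹' ((Ioi (0 : ℝ)) ×ˢ (univ : Set (Path t))) =
      {ω | 0 < X₀ ω} := by
    ext ω
    simp
  -- Unnormalized form of the conclusion. Its total mass gives the probability of survival, and its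
  -- first marginal the law of `X₀`.
  have hrestr : (P.restrict {ω | 0 < X₀ ω}).map (fun ω => (X₀ ω, 𝔛 ω)) =
      (initialLaw (q t) (l t)).restrict (Ioi 0) ⊗ₘ branchKernel t (rateOf q l) := by
    rw [← hf.flowLaw_restrict, ← hPY, Measure.restrict_map_of_aemeasurable hY hS, hpre]
  have hpath : ∀ x, 0 < x → branchingPath t ρ x = branchPath t (rateOf q l) 0 x := by
    intro x hx
    funext Z s w
    exact (branchingMass_congr hρ ht.le w Z x ht.le s.2.2).trans
      (branchMass_eq_branchingMass hf.continuous_rateOf hf.rateOf_pos w Z hx.le s.2).symm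
  refine ⟨hX, measurable_snd.comp_aemeasurable hY, ?_, fun x hx => ?_,
    branchKernel t (rateOf q l), hκ, fun x hx => ?_, ?_⟩
  · have h : P {ω | 0 < X₀ ω} = initialLaw (q t) (l t) (Ioi 0) := by
      have h1 := congrArg (fun m => m univ) hrestr
      simp only [Measure.compProd_apply_univ, Measure.restrict_apply_univ] at h1
      rwa [Measure.map_apply_of_aemeasurable hY.restrict MeasurableSet.univ, preimage_univ,
        Measure.restrict_apply_univ] at h1
    rw [h]
    exact initialLaw_Ioi_pos (hf.p_lt_one t) (hf.lam_pos t)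
  · rw [hpath x hx]
    exact (measurable_branchPath hf.continuous_rateOf hf.rateOf_pos measurable_const
      measurable_const measurable_id).aemeasurable
  · rw [hf.branchKernel_apply hx, branchingLaw, hpath x hx]
  · have hfst : (P.restrict {ω | 0 < X₀ ω}).map X₀ = (initialLaw (q t) (l t)).restrict (Ioi 0) := by
      rw [← Measure.fst_compProd ((initialLaw (q t) (l t)).restrict (Ioi 0))
        (branchKernel t (rateOf q l)), ← hrestr, Measure.fst,
        AEMeasurable.map_map_of_aemeasurable measurable_fst.aemeasurable hY.restrict]
      rfl
    -- Conditioning multiplies both sides by the same constant.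
    rw [ProbabilityTheory.cond, Measure.map_smul, Measure.map_smul, hfst, hrestr,
      Measure.compProd_smul_left]
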